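/- Matrices in $M_m(\mathbb C)\otimes M_n(\mathbb C)$ are regarded as $mn\times mn$ matrices. A Hermitian matrix $W\in M_m(\mathbb C)\otimes M_n(\mathbb C)$ is block-positive if $\langle a,b|W|a,b\rangle\ge 0$ for all $|a\rangle\in\mathbb C^m$, $|b\rangle\in\mathbb C^n$, where $|a,b\rangle=|a\rangle\otimes|b\rangle$. An $m\times n$ entanglement witness (EW) is a block-positive matrix with at least one negative eigenvalue; it is normalized if $\operatorname{tr}W=1$. Its eigenvalues, counted with multiplicity, are written $\lambda_1\ge\lambda_2\ge\cdots\ge\lambda_{mn}$. A state is a positive semidefinite matrix of trace one. It is separable if it is a finite convex combination of matrices $|v\rangle\langle v|\otimes|w\rangle\langle w|$ with unit vectors $v\in\mathbb C^m$, $w\in\mathbb C^n$, and entangled otherwise. For an EW $W$ let $D_W$ be the set of entangled states $\rho$ with $\operatorname{tr}(W\rho)<0$; an EW $W_1$ is finer than $W$ if $D_W\subseteq D_{W_1}$. An EW $W$ is optimal if no other EW is finer than $W$, where EWs that are positive multiples of each other are regarded as the same. Let $\mathcal N(W)=\frac{\|W\|_1-1}{2}$ with $\|W\|_1=\operatorname{tr}\sqrt{W^\dagger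 W}$; for a Hermitian $W$ with $\operatorname{tr} W=1$ this is the absolute value of the sum of the negative eigenvalues. **Lemma.** Let $W$ be an arbitrary normalized $m\times n$ EW. Then: (i) $\operatorname{tr}(W^2)\in\left(\frac1{mn-1},1\right]$. (ii) $\lambda_{mn}\in\left[-\frac12,0\right)$. If $\lambda_{mn}=-\frac12$, then $W$ is optimal. (iii) $\lambda_1\in\left(\frac1{mn-1},1\right)$. (iv) If $m=2$, then (a) $\lambda_2+\lambda_{2n}\ge0$; (b) $\sum_{i=3}^{2n}\lambda_i\ge-\frac1{2+2\sqrt2}$; (c) $\sum_{i=k}^{2n}\lambda_i\ge-\frac12$ for every $k$ with $4\le k\le 2n$. (v) If $m=n$, then $\mathcal N(W)\le\frac{m-1}2$. If equality holds, then $W$ is optimal and has the eigenvalue $\frac1m$ with multiplicity $\frac{m(m+1)}2$ and the eigenvalue $-\frac1m$ with multiplicity $\frac{m(m-1)}2$. -/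

import Mathlib

open scoped Kronecker ComplexOrder

/-- Matrices in `M_m(ℂ) ⊗ M_n(ℂ)`, with rows and columns indexed by pairs. -/
abbrev BipartiteMatrix (m n : ℕ) := Matrix (Fin m × Fin n) (Fin m × Fin n) ℂ

/-- The product vector `a ⊗ b` in `ℂ^m ⊗ ℂ^n`. -/
def productVector {m n : ℕ} (a : Fin m → ℂ) (b : Fin n → ℂ) : Fin m × Fin n → ℂ :=
  fun p => a p.1 * b p.2

/-- A Hermitian matrix `W` is block-positive if `⟨a,b|W|a,b⟩ ≥ 0` for all product vectors. The
value is real because `W` is Hermitian, so that taking the real part loses nothing. -/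
structure IsBlockPositive {m n : ℕ} (W : BipartiteMatrix m n) : Prop where
  isHermitian : W.IsHermitian
  nonneg : ∀ (a : Fin m → ℂ) (b : Fin n → ℂ),
    0 ≤ (star (productVector a b) ⬝ᵥ W.mulVec (productVector a b)).re

/-- An entanglement witness: a block-positive matrix with at least one negative eigenvalue. -/
structure IsEntanglementWitness {m n : ℕ} (W : BipartiteMatrix m n) : Prop
    extends IsBlockPositive W where
  exists_neg : ∃ i, isHermitian.eigenvalues i < 0

/-- A quantum state: a positive semidefinite matrix of trace one. -/
structure IsQuantumState {m n : ℕ} (ρ : BipartiteMatrix m n) : Prop where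
  posSemidef : ρ.PosSemidef
  trace_eq_one : ρ.trace = 1

/-- A separable state: a finite convex combination `∑ pᵢ |vᵢ⟩⟨vᵢ| ⊗ |wᵢ⟩⟨wᵢ|` with unit
vectors `vᵢ` and `wᵢ`. -/
def IsSeparableState {m n : ℕ} (ρ : BipartiteMatrix m n) : Prop :=
  ∃ (N : ℕ) (p : Fin N → ℝ) (v : Fin N → Fin m → ℂ) (w : Fin N → Fin n → ℂ),
    (∀ i, 0 ≤ p i) ∧ ∑ i, p i = 1 ∧
    (∀ i, star (v i) ⬝ᵥ v i = 1) ∧ (∀ i, star (w i) ⬝ᵥ w i = 1) ∧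
    ρ = ∑ i, (p i : ℂ) •
      (Matrix.vecMulVec (v i) (star (v i)) ⊗ₖ Matrix.vecMulVec (w i) (star (w i)))

/-- The set `D_W` of all entangled (that is, non-separable) states `ρ` detected by `W`, i.e. with
`tr (W ρ) < 0`. The trace is real because both matrices are Hermitian. -/
def detectedStates {m n : ℕ} (W : BipartiteMatrix m n) : Set (BipartiteMatrix m n) :=
  {ρ | IsQuantumState ρ ∧ ¬ IsSeparableState ρ ∧ (W * ρ).trace.re < 0}

/-- `W₁` is finer than `W₂` if it detects every entangled state that `W₂` detects. -/
def IsFiner {m n : ℕ} (W₁ W₂ : BipartiteMatrix m n) : Prop :=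
  detectedStates W₂ ⊆ detectedStates W₁

/-- `W` is an optimal entanglement witness if no other entanglement witness is finer than `W`.
Witnesses count as the same here when they are positive multiples of each other (these detect
exactly the same states). -/
def IsOptimalWitness {m n : ℕ} (W : BipartiteMatrix m n) : Prop :=
  IsEntanglementWitness W ∧
    ∀ W₁ : BipartiteMatrix m n, IsEntanglementWitness W₁ → IsFiner W₁ W →
      ∃ c : ℝ, 0 < c ∧ W₁ = (c : ℂ) • W

/-- The `k`-th largest eigenvalue `λ_k` of a Hermitian matrix of order `m n`, counted with
multiplicity, for `1 ≤ k ≤ m n`: `λ_1 ≥ λ_2 ≥ ⋯ ≥ λ_{mn}` (and `0` for other `k`). -/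
noncomputable def sortedEigenvalue {m n : ℕ} {W : BipartiteMatrix m n} (hW : W.IsHermitian)
    (k : ℕ) : ℝ :=
  if h : 1 ≤ k ∧ k ≤ Fintype.card (Fin m × Fin n) then
    hW.eigenvalues₀ ⟨k - 1, by omega⟩
  else 0

/-- The trace norm `‖M‖₁ = tr √(M† M)`, the sum of the square roots of the eigenvalues
of `M† M`. -/
noncomputable def traceNorm {m n : ℕ} (M : BipartiteMatrix m n) : ℝ :=
  ∑ i, √((Matrix.isHermitian_conjTranspose_mul_self M).eigenvalues i)

/-- The negativity `N(M) = (‖M‖₁ - 1) / 2`. For a Hermitian matrix of trace one it is the absolute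
value of the sum of the negative eigenvalues. -/
noncomputable def negativity {m n : ℕ} (M : BipartiteMatrix m n) : ℝ :=
  (traceNorm M - 1) / 2

/-! Everything comes from testing block-positivity on well-chosen product vectors.

Purity. For every a the partial form T = ⟨a|W|a⟩ is positive semidefinite, so tr T² ≤ (tr T)².
Averaging over the phases of the coordinates of a, and adding the same inequality with the factors
exchanged, yields tr W² ≤ (tr W)² (`IsBlockPositive.trace_mul_self_le`). With tr W = 1 and a
negative eigenvalue this gives (i) and (iii); compared with the m² singular values it gives the
bound in (v).

Least eigenvalue. For ψ in Schmidt form ∑ sⱼ|jj⟩, averaging over the product vectors with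
coordinates √sⱼ zⱼ and √sⱼ z̄ⱼ bounds ⟨ψ|W|ψ⟩ below by minus the sum of sᵢsₖ⟨ik|W|ik⟩ over i ≠ k,
hence by -tr W / 2 (`IsBlockPositive.neg_half_trace_le`).

Optimality. If W₁ is finer than W, separation in the plane makes some αW - βW₁ positive semidefinite
(`IsFiner.exists_posSemidef`). If W also minimizes tr(WQ) for some Q ≥ 0, with negative minimum,
this difference has trace zero and vanishes. For the eigenvalue -1/2, Q is the projector onto the
eigenvector; in (v) it is 1 - mW.

Two rows. For (iv)(a), a negative eigenvector lives in a two-qubit space and becomes a product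
vector after adding a vector of length at most one, orthogonal to it and to the top eigenvector
(`exists_orthogonal_det_eq_zero`). For (b) and (c), let P, X, Q be the blocks of W. From |⟨g,Xg⟩|² ≤
⟨g,Pg⟩⟨g,Qg⟩ and the diagonalization of unitaries, the trace of X against a corner of a unitary is
at most √(tr P tr Q) (`IsBlockPositive.norm_trace_mul_submatrix_le`). Applied to the reflection in
the span of an orthonormal family this gives (c); after rotating the qubit and a pair of vectors it
bounds λ₁ + λ₂ by (1 + √2)/2, which is (b). -/

open Matrix

/-! ### Phase averaging over cube roots of unity -/

theorem addChar_map_sum {ι A R : Type*} [AddCommMonoid A] [CommMonoid R] (ψ : AddChar A R)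
    (s : Finset ι) (f : ι → A) : ψ (∑ i ∈ s, f i) = ∏ i ∈ s, ψ (f i) := by
  classical
  induction s using Finset.induction_on with
  | empty => simp
  | insert a s ha ih => rw [Finset.sum_insert ha, Finset.prod_insert ha, ψ.map_add_eq_mul, ih]

/-- Orthogonality of products of four phases ranging over cube roots of unity. -/
theorem sum_cubeRoot_phases {ι : Type*} [Fintype ι] [DecidableEq ι] (i j k l : ι) :
    ∑ z : ι → ZMod 3, star (ZMod.stdAddChar (z i) : ℂ) * ZMod.stdAddChar (z j) *
      star (ZMod.stdAddChar (z k) : ℂ) * ZMod.stdAddChar (z l) =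
      if (i = j ∧ k = l) ∨ (i = l ∧ j = k) then (3 : ℂ) ^ Fintype.card ι else 0 := by
  -- The total exponent of the phase z p: the sum over z factors into character sums that vanish
  -- unless c p = 0.
  set c : ι → ZMod 3 := fun p => (if p = j then 1 else 0) + (if p = l then 1 else 0)
    - (if p = i then 1 else 0) - (if p = k then 1 else 0) with hc
  have h1 : ∀ z : ι → ZMod 3, star (ZMod.stdAddChar (z i) : ℂ) * ZMod.stdAddChar (z j) *
      star (ZMod.stdAddChar (z k) : ℂ) * ZMod.stdAddChar (z l) =
      ∏ p, ZMod.stdAddChar (z p * c p) := by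
    intro z
    rw [← addChar_map_sum]
    have : ∑ p, z p * c p = -z i + z j + -z k + z l := by
      simp only [hc, mul_add, mul_sub, Finset.sum_add_distrib, Finset.sum_sub_distrib, mul_ite,
        mul_one, mul_zero, Finset.sum_ite_eq', Finset.mem_univ, if_true]
      ring
    rw [this]
    simp only [AddChar.map_add_eq_mul, AddChar.map_neg_eq_conj]
    rfl
  simp_rw [h1]
  have h2 := Finset.prod_univ_sum (fun _ : ι => (Finset.univ : Finset (ZMod 3)))
    (fun p t => (ZMod.stdAddChar (t * c p) : ℂ))
  rw [Fintype.piFinset_univ] at h2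
  rw [← h2]
  have h3 : ∀ p, ∑ t : ZMod 3, (ZMod.stdAddChar (t * c p) : ℂ) = if c p = 0 then 3 else 0 := by
    intro p
    rw [AddChar.sum_mulShift _ (ZMod.isPrimitive_stdAddChar 3)]
    simp
  simp_rw [h3]
  by_cases h : (i = j ∧ k = l) ∨ (i = l ∧ j = k)
  · rw [if_pos h]
    have : ∀ p, c p = 0 := by
      intro p
      rcases h with ⟨rfl, rfl⟩ | ⟨rfl, rfl⟩ <;> simp only [hc] <;> ring
    simp [this]
  · rw [if_neg h]
    have : ∃ p, c p ≠ 0 := by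
      have a1 : (1 : ZMod 3) ≠ 0 := by decide
      have a2 : (1 + 1 : ZMod 3) ≠ 0 := by decide
      by_cases e1 : i = j
      · have e2 : k ≠ l := fun h' => h (Or.inl ⟨e1, h'⟩)
        refine ⟨k, ?_⟩
        simp [hc, e1, e2]
      · by_cases e2 : i = l
        · have e3 : j ≠ k := fun h' => h (Or.inr ⟨e2, h'⟩)
          have e4 : j ≠ l := fun h' => e1 (e2.trans h'.symm)
          refine ⟨j, ?_⟩
          simp [hc, e3, e4, Ne.symm e1]
        · refine ⟨i, ?_⟩
          -- If i = k the exponent is -2, nonzero modulo three. Signs instead of cube roots would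
          -- let the pairing i = k, j = l survive.
          by_cases e3 : i = k
          · simp only [hc, if_neg e1, if_neg e2, if_pos e3, if_true]
            decide
          · simp [hc, e1, e2, e3]
    obtain ⟨p, hp⟩ := this
    exact Finset.prod_eq_zero (Finset.mem_univ p) (by simp [hp])

/-- Only patterns whose phases cancel in conjugate pairs survive the average; the subtracted sum
corrects for the all-equal pattern, which belongs to both pairings. -/
theorem phase_average_nonneg {ι : Type*} [Fintype ι] [DecidableEq ι] (F : ι → ι → ι → ι → ℂ)
    (hF : ∀ z : ι → ℂ, (∀ i, star (z i) * z i = 1) →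
      0 ≤ (∑ i, ∑ j, ∑ k, ∑ l, star (z i) * z j * star (z k) * z l * F i j k l).re) :
    0 ≤ (∑ i, ∑ k, F i i k k + ∑ i, ∑ j, F i j j i - ∑ i, F i i i i).re := by
  have h0 : 0 ≤ ∑ z : ι → ZMod 3, (∑ i, ∑ j, ∑ k, ∑ l, star (ZMod.stdAddChar (z i) : ℂ) *
      ZMod.stdAddChar (z j) * star (ZMod.stdAddChar (z k) : ℂ) * ZMod.stdAddChar (z l)
        * F i j k l).re := by
    refine Finset.sum_nonneg fun z _ => hF (fun i => ZMod.stdAddChar (z i)) fun i => ?_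
    have := AddChar.map_neg_eq_conj (ZMod.stdAddChar (N := 3)) (z i)
    change starRingEnd ℂ _ * _ = 1
    rw [← this, ← AddChar.map_add_eq_mul]
    simp
  rw [← Complex.re_sum] at h0
  have h1 : ∑ z : ι → ZMod 3, (∑ i, ∑ j, ∑ k, ∑ l, star (ZMod.stdAddChar (z i) : ℂ) *
      ZMod.stdAddChar (z j) * star (ZMod.stdAddChar (z k) : ℂ) * ZMod.stdAddChar (z l)
        * F i j k l) = (3 : ℂ) ^ Fintype.card ι *
        (∑ i, ∑ k, F i i k k + ∑ i, ∑ j, F i j j i - ∑ i, F i i i i) := by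
    rw [Finset.sum_comm]
    simp_rw [Finset.sum_comm (s := (Finset.univ : Finset (ι → ZMod 3))), ← Finset.sum_mul,
      sum_cubeRoot_phases]
    have h2 : ∀ i j k l : ι, (if (i = j ∧ k = l) ∨ (i = l ∧ j = k) then
        (3 : ℂ) ^ Fintype.card ι else 0) * F i j k l = (3 : ℂ) ^ Fintype.card ι *
        ((if i = j then if k = l then F i i k k else 0 else 0) +
          (if i = l then if j = k then F i j j i else 0 else 0) -
          (if i = j then if i = k then if i = l then F i i i i else 0 else 0 else 0)) := by
      intro i j k l
      by_cases e1 : i = j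
      · subst e1
        by_cases e2 : k = l
        · subst e2
          by_cases e3 : i = k <;> simp [e3]
        · by_cases e3 : i = l
          · subst e3
            simp [e2, Ne.symm e2]
          · simp [e2, e3]
      · by_cases e3 : i = l
        · subst e3
          by_cases e4 : j = k
          · subst e4
            simp [e1]
          · simp [e1, e4]
        · simp [e1, e3]
    simp_rw [h2, ← Finset.mul_sum]
    congr 1
    simp only [Finset.sum_sub_distrib, Finset.sum_add_distrib]
    congr 1
    · congr 1
      · refine Finset.sum_congr rfl fun i _ => ?_
        rw [Finset.sum_eq_single i (by intro b _ hb; simp [hb.symm]) (by simp)]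
        refine Finset.sum_congr rfl fun k _ => ?_
        simp
      · refine Finset.sum_congr rfl fun i _ => Finset.sum_congr rfl fun j _ => ?_
        rw [Finset.sum_eq_single j (by intro b _ hb; simp [hb.symm]) (by simp)]
        simp
    · refine Finset.sum_congr rfl fun i _ => ?_
      rw [Finset.sum_eq_single i (by intro b _ hb; simp [hb.symm]) (by simp),
        Finset.sum_eq_single i (by intro b _ hb; simp [hb.symm]) (by simp)]
      simp
  rw [h1] at h0
  have h3 : ((3 : ℂ) ^ Fintype.card ι) = ((3 ^ Fintype.card ι : ℝ) : ℂ) := by push_cast; rfl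
  rw [h3, Complex.re_ofReal_mul] at h0
  exact nonneg_of_mul_nonneg_right h0 (by positivity)

/-! ### Local filters -/

section LocalConjugation

variable {m n m' n' : ℕ}

theorem kronecker_mulVec_productVector (A : Matrix (Fin m) (Fin m') ℂ)
    (B : Matrix (Fin n) (Fin n') ℂ) (a : Fin m' → ℂ) (b : Fin n' → ℂ) :
    (A ⊗ₖ B) *ᵥ productVector a b = productVector (A *ᵥ a) (B *ᵥ b) := by
  ext ⟨i, k⟩
  simp only [mulVec, dotProduct, productVector, kroneckerMap_apply, Fintype.sum_prod_type,
    Finset.sum_mul_sum]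
  exact Finset.sum_congr rfl fun _ _ => Finset.sum_congr rfl fun _ _ => by ring

theorem dotProduct_conj_mulVec {ι κ : Type*} [Fintype ι] [Fintype κ] (W : Matrix ι ι ℂ)
    (K : Matrix ι κ ℂ) (x y : κ → ℂ) :
    star x ⬝ᵥ (Kᴴ * W * K) *ᵥ y = star (K *ᵥ x) ⬝ᵥ W *ᵥ (K *ᵥ y) := by
  rw [star_mulVec, dotProduct_mulVec, dotProduct_mulVec, dotProduct_mulVec, vecMul_vecMul,
    vecMul_vecMul]
  simp [Matrix.mul_assoc]

/-- Block-positivity is preserved by local filters. -/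
theorem IsBlockPositive.localConj {W : BipartiteMatrix m n} (hW : IsBlockPositive W)
    (A : Matrix (Fin m) (Fin m') ℂ) (B : Matrix (Fin n) (Fin n') ℂ) :
    IsBlockPositive ((A ⊗ₖ B)ᴴ * W * (A ⊗ₖ B)) where
  isHermitian := isHermitian_conjTranspose_mul_mul _ hW.isHermitian
  nonneg a b := by
    rw [dotProduct_conj_mulVec, kronecker_mulVec_productVector]
    exact hW.nonneg _ _

theorem productVector_single (i : Fin m) (k : Fin n) :
    productVector (Pi.single i 1) (Pi.single k 1) = Pi.single (i, k) (1 : ℂ) := by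
  ext ⟨j, l⟩
  simp only [productVector, Pi.single_apply, Prod.mk.injEq]
  by_cases h1 : j = i <;> by_cases h2 : l = k <;> simp [h1, h2]

theorem IsBlockPositive.diag_nonneg {W : BipartiteMatrix m n} (hW : IsBlockPositive W)
    (p : Fin m × Fin n) : 0 ≤ (W p p).re := by
  have := hW.nonneg (Pi.single p.1 1) (Pi.single p.2 1)
  rw [productVector_single] at this
  simpa [Pi.star_single] using this

theorem IsBlockPositive.trace_nonneg {W : BipartiteMatrix m n} (hW : IsBlockPositive W) :
    0 ≤ W.trace.re := by
  rw [trace, Complex.re_sum]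
  exact Finset.sum_nonneg fun p _ => hW.diag_nonneg p

/-- The matrix `W` with the two tensor factors exchanged. -/
def swapFactors (W : BipartiteMatrix m n) : BipartiteMatrix n m :=
  W.submatrix Prod.swap Prod.swap

theorem IsBlockPositive.swapFactors {W : BipartiteMatrix m n} (hW : IsBlockPositive W) :
    IsBlockPositive (swapFactors W) where
  isHermitian := hW.isHermitian.submatrix _
  nonneg b a := by
    have h := hW.nonneg a b
    convert h using 2
    simp only [dotProduct, mulVec, _root_.swapFactors, submatrix_apply, Fintype.sum_prod_type,
      Prod.swap_prod_mk, productVector, Pi.star_apply]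
    rw [Finset.sum_comm]
    refine Finset.sum_congr rfl fun i _ => Finset.sum_congr rfl fun k _ => ?_
    rw [Finset.sum_comm, mul_comm (a i)]
    congr 1
    exact Finset.sum_congr rfl fun j _ => Finset.sum_congr rfl fun l _ => by ring

/-- Filtering one factor by a partial isometry does not increase the trace. -/
theorem IsBlockPositive.trace_localConj_le {W : BipartiteMatrix m n} (hW : IsBlockPositive W)
    {Y : Matrix (Fin m) (Fin m') ℂ} (hY : Y * Yᴴ = 1) {E : Matrix (Fin n) (Fin n') ℂ}
    (hE : E * (Eᴴ * E) = E) :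
    ((Y ⊗ₖ E)ᴴ * W * (Y ⊗ₖ E)).trace.re ≤ W.trace.re := by
  -- The trace lost by filtering is the trace of W filtered by the complementary projection 1 - EEᴴ,
  -- which is nonnegative.
  have h1 := (hW.localConj (1 : Matrix (Fin m) (Fin m) ℂ) (1 - E * Eᴴ)).trace_nonneg
  have hR : (1 - E * Eᴴ) * (1 - E * Eᴴ)ᴴ = 1 - E * Eᴴ := by
    have : E * Eᴴ * (E * Eᴴ) = E * Eᴴ := by
      rw [← Matrix.mul_assoc, Matrix.mul_assoc E, hE]
    simp [conjTranspose_sub, conjTranspose_mul, sub_mul, mul_sub, this]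
  have h2 : ((1 ⊗ₖ (1 - E * Eᴴ))ᴴ * W * ((1 : Matrix (Fin m) (Fin m) ℂ) ⊗ₖ (1 - E * Eᴴ))).trace
      = W.trace - ((Y ⊗ₖ E)ᴴ * W * (Y ⊗ₖ E)).trace := by
    rw [trace_mul_cycle, trace_mul_cycle (Y ⊗ₖ E)ᴴ, conjTranspose_kronecker, conjTranspose_kronecker,
      ← mul_kronecker_mul, ← mul_kronecker_mul, hR, hY]
    have h3 : (1 : Matrix (Fin m) (Fin m) ℂ) ⊗ₖ (1 - E * Eᴴ) = 1 - 1 ⊗ₖ (E * Eᴴ) := by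
      rw [eq_sub_iff_add_eq, ← kronecker_add, sub_add_cancel, one_kronecker_one]
    rw [conjTranspose_one, Matrix.mul_one, h3, sub_mul, Matrix.one_mul, trace_sub]
  rw [h2, Complex.sub_re] at h1
  linarith

end LocalConjugation

/-! ### The purity bound -/

theorem Matrix.PosSemidef.trace_mul_self_le {ι : Type*} [Fintype ι] [DecidableEq ι]
    {T : Matrix ι ι ℂ} (hT : T.PosSemidef) : (T * T).trace.re ≤ (T.trace * T.trace).re := by
  have h1 : (T * T).trace = ∑ k, ∑ l, ((‖T k l‖ ^ 2 : ℝ) : ℂ) := by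
    simp only [trace, diag_apply, mul_apply]
    refine Finset.sum_congr rfl fun k _ => Finset.sum_congr rfl fun l _ => ?_
    rw [← hT.isHermitian.apply l k]
    change _ * starRingEnd ℂ _ = _
    rw [Complex.mul_conj, Complex.normSq_eq_norm_sq]
  have hd : ∀ k, T k k = ((T k k).re : ℂ) ∧ 0 ≤ (T k k).re := fun k => by
    have := hT.diag_nonneg (i := k)
    rw [Complex.le_def] at this
    exact ⟨by apply Complex.ext <;> simp [← this.2], this.1⟩
  have h2 : T.trace * T.trace = ∑ k, ∑ l, (((T k k).re * (T l l).re : ℝ) : ℂ) := by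
    simp only [trace, diag_apply, Finset.sum_mul_sum]
    refine Finset.sum_congr rfl fun k _ => Finset.sum_congr rfl fun l _ => ?_
    rw [(hd k).1, (hd l).1]
    push_cast
    simp
  rw [h1, h2]
  simp only [Complex.re_sum, Complex.ofReal_re]
  refine Finset.sum_le_sum fun k _ => Finset.sum_le_sum fun l _ => ?_
  -- The 2 × 2 principal minors give |T k l|² ≤ T k k · T l l, entry by entry.
  have h3 := (hT.submatrix ![k, l]).det_nonneg
  rw [det_fin_two] at h3
  simp only [submatrix_apply, cons_val_zero, cons_val_one] at h3
  rw [← hT.isHermitian.apply l k] at h3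
  change 0 ≤ T k k * T l l - T k l * starRingEnd ℂ (T k l) at h3
  rw [Complex.mul_conj, Complex.normSq_eq_norm_sq, (hd k).1, (hd l).1] at h3
  have := (Complex.le_def.1 h3).1
  simp only [Complex.sub_re, Complex.zero_re, Complex.ofReal_re, Complex.re_ofReal_mul] at this
  linarith

section TraceSquare

variable {m n : ℕ}

/-- The `n × n` block of `W` in position `(i, j)`. -/
def tensorBlock (W : BipartiteMatrix m n) (i j : Fin m) : Matrix (Fin n) (Fin n) ℂ :=
  Matrix.of fun k l => W (i, k) (j, l)

/-- The partial quadratic form `⟨a|W|a⟩`, a matrix acting on the second factor. -/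
noncomputable def partialForm (W : BipartiteMatrix m n) (a : Fin m → ℂ) :
    Matrix (Fin n) (Fin n) ℂ :=
  ∑ i, ∑ j, (star (a i) * a j) • tensorBlock W i j

theorem tensorBlock_conjTranspose {W : BipartiteMatrix m n} (hW : W.IsHermitian) (i j : Fin m) :
    (tensorBlock W i j)ᴴ = tensorBlock W j i := by
  ext k l
  simp only [tensorBlock, conjTranspose_apply, of_apply]
  exact hW.apply _ _

theorem dotProduct_productVector (W : BipartiteMatrix m n) (a a' : Fin m → ℂ) (b b' : Fin n → ℂ) :
    star (productVector a b) ⬝ᵥ W *ᵥ productVector a' b' =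
      ∑ i, ∑ j, star (a i) * a' j * (star b ⬝ᵥ tensorBlock W i j *ᵥ b') := by
  simp only [dotProduct, mulVec, Fintype.sum_prod_type, productVector, Pi.star_apply, tensorBlock,
    of_apply, Finset.mul_sum]
  refine Finset.sum_congr rfl fun i _ => ?_
  rw [Finset.sum_comm]
  refine Finset.sum_congr rfl fun j _ => Finset.sum_congr rfl fun k _ =>
    Finset.sum_congr rfl fun l _ => ?_
  rw [star_mul']
  ring

theorem dotProduct_partialForm (W : BipartiteMatrix m n) (a : Fin m → ℂ) (b : Fin n → ℂ) :
    star b ⬝ᵥ partialForm W a *ᵥ b = star (productVector a b) ⬝ᵥ W *ᵥ productVector a b := by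
  rw [dotProduct_productVector, partialForm]
  simp only [sum_mulVec, dotProduct_sum, smul_mulVec, dotProduct_smul, smul_eq_mul]

theorem IsBlockPositive.posSemidef_partialForm {W : BipartiteMatrix m n} (hW : IsBlockPositive W)
    (a : Fin m → ℂ) : (partialForm W a).PosSemidef := by
  have hH : (partialForm W a).IsHermitian := by
    rw [IsHermitian, partialForm, conjTranspose_sum, Finset.sum_comm]
    simp only [conjTranspose_sum, conjTranspose_smul, tensorBlock_conjTranspose hW.isHermitian]
    refine Finset.sum_congr rfl fun i _ => Finset.sum_congr rfl fun j _ => ?_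
    simp [mul_comm]
  refine PosSemidef.of_dotProduct_mulVec_nonneg hH fun b => ?_
  rw [dotProduct_partialForm, Complex.le_def]
  refine ⟨hW.nonneg a b, ?_⟩
  exact (hW.isHermitian.im_star_dotProduct_mulVec_self _).symm

theorem sum_comm_pairs {ι κ : Type*} [Fintype ι] [Fintype κ] (f : ι → ι → κ → κ → ℂ) :
    ∑ i, ∑ j, ∑ k, ∑ l, f i j k l = ∑ k, ∑ l, ∑ i, ∑ j, f i j k l := by
  have := Finset.sum_comm (s := (Finset.univ : Finset (ι × ι)))
    (t := (Finset.univ : Finset (κ × κ))) (f := fun p q => f p.1 p.2 q.1 q.2)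
  simpa only [Fintype.sum_prod_type] using this

/-- With A and B the reductions of W to the first and second factor, this reads (tr W)² - tr B² + tr
A² - tr W² ≥ 0. It is the phase average of (tr T)² - tr T² ≥ 0 over the partial forms T. -/
theorem IsBlockPositive.partial_trace_inequality {W : BipartiteMatrix m n}
    (hW : IsBlockPositive W) :
    0 ≤ ((W.trace * W.trace - ∑ i, ∑ j, (tensorBlock W i i * tensorBlock W j j).trace) +
      (∑ i, ∑ j, (tensorBlock W i j).trace * (tensorBlock W j i).trace - (W * W).trace)).re := by
  set F : Fin m → Fin m → Fin m → Fin m → ℂ := fun i j k l =>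
    (tensorBlock W i j).trace * (tensorBlock W k l).trace -
      (tensorBlock W i j * tensorBlock W k l).trace with hF
  have h0 : ∀ a : Fin m → ℂ,
      0 ≤ (∑ i, ∑ j, ∑ k, ∑ l, star (a i) * a j * star (a k) * a l * F i j k l).re := by
    intro a
    have h := (hW.posSemidef_partialForm a).trace_mul_self_le
    rw [← sub_nonneg, ← Complex.sub_re] at h
    convert h using 2
    simp only [partialForm, trace_sum, trace_smul, Finset.sum_mul, smul_eq_mul]
    simp only [Finset.mul_sum, trace_sum, smul_mul_assoc, mul_smul_comm, trace_smul, smul_eq_mul,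
      ← Finset.sum_sub_distrib]
    refine Finset.sum_congr rfl fun i _ => Finset.sum_congr rfl fun j _ =>
      Finset.sum_congr rfl fun k _ => Finset.sum_congr rfl fun l _ => ?_
    simp only [hF]
    ring
  have h1 := phase_average_nonneg F fun z _ => h0 z
  -- The all-equal terms subtracted by the average are nonnegative, since a basis vector isolates
  -- each of them, and can be added back.
  have h2 : 0 ≤ (∑ i, F i i i i).re := by
    rw [Complex.re_sum]
    refine Finset.sum_nonneg fun i _ => ?_
    have := h0 (Pi.single i 1)
    simpa [Pi.single_apply] using this
  have h3 := add_nonneg h1 h2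
  rw [← Complex.add_re, sub_add_cancel] at h3
  refine h3.trans_eq (congrArg Complex.re (Eq.symm ?_))
  simp only [hF, Finset.sum_sub_distrib]
  have e1 : W.trace * W.trace =
      ∑ i, ∑ k, (tensorBlock W i i).trace * (tensorBlock W k k).trace := by
    rw [← Finset.sum_mul_sum]
    congr 1 <;> simp [trace, Fintype.sum_prod_type, tensorBlock]
  have e2 : (W * W).trace = ∑ i, ∑ j, (tensorBlock W i j * tensorBlock W j i).trace := by
    simp only [trace, diag_apply, mul_apply, Fintype.sum_prod_type, tensorBlock, of_apply]
    exact Finset.sum_congr rfl fun i _ => Finset.sum_comm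
  rw [e1, e2]

/-- Block-positive matrices satisfy `tr W² ≤ (tr W)²`. -/
theorem IsBlockPositive.trace_mul_self_le {W : BipartiteMatrix m n} (hW : IsBlockPositive W) :
    (W * W).trace.re ≤ (W.trace * W.trace).re := by
  have h1 := hW.partial_trace_inequality
  -- Exchanging the factors exchanges the two reductions, so their contributions cancel in the sum.
  have h2 := hW.swapFactors.partial_trace_inequality
  have e1 : (_root_.swapFactors W).trace = W.trace := by
    simp only [trace, diag_apply, _root_.swapFactors, submatrix_apply, Fintype.sum_prod_type,
      Prod.swap_prod_mk]
    exact Finset.sum_comm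
  have e2 : (_root_.swapFactors W * _root_.swapFactors W).trace = (W * W).trace := by
    simp only [trace, diag_apply, mul_apply, _root_.swapFactors, submatrix_apply,
      Fintype.sum_prod_type, Prod.swap_prod_mk]
    rw [Finset.sum_comm]
    exact Finset.sum_congr rfl fun i _ => Finset.sum_congr rfl fun k _ => Finset.sum_comm
  have e3 : ∑ i, ∑ j, (tensorBlock (_root_.swapFactors W) i i *
      tensorBlock (_root_.swapFactors W) j j).trace =
      ∑ i, ∑ j, (tensorBlock W i j).trace * (tensorBlock W j i).trace := by
    simp only [trace, diag_apply, mul_apply, _root_.swapFactors, submatrix_apply, tensorBlock,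
      of_apply, Prod.swap_prod_mk, Finset.sum_mul_sum]
    exact sum_comm_pairs _
  have e4 : ∑ i, ∑ j, (tensorBlock (_root_.swapFactors W) i j).trace *
      (tensorBlock (_root_.swapFactors W) j i).trace =
      ∑ i, ∑ j, (tensorBlock W i i * tensorBlock W j j).trace := by
    simp only [trace, diag_apply, mul_apply, _root_.swapFactors, submatrix_apply, tensorBlock,
      of_apply, Prod.swap_prod_mk, Finset.sum_mul_sum]
    exact sum_comm_pairs _
  rw [e1, e2, e3, e4] at h2
  simp only [Complex.add_re, Complex.sub_re] at h1 h2
  linarith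

end TraceSquare

/-- A singular value decomposition with square left factor: `M = Y diag(s) Eᵀ` with `Y` unitary
and `E` a partial isometry whose columns vanish where `s` does. -/
theorem exists_singular_value_decomposition {m n : ℕ} (M : Matrix (Fin m) (Fin n) ℂ) :
    ∃ (Y : Matrix (Fin m) (Fin m) ℂ) (E : Matrix (Fin n) (Fin m) ℂ) (s : Fin m → ℝ),
      Y * Yᴴ = 1 ∧ (∀ j, 0 ≤ s j) ∧ Eᴴ * E = diagonal (fun j => if s j = 0 then 0 else 1) ∧
      E * (Eᴴ * E) = E ∧ ∀ i k, M i k = ∑ j, (s j : ℂ) * (Y i j * E k j) := by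
  have hH : (M * Mᴴ).IsHermitian := isHermitian_mul_conjTranspose_self M
  have hP : (M * Mᴴ).PosSemidef := posSemidef_self_mul_conjTranspose M
  set Y : Matrix (Fin m) (Fin m) ℂ := (hH.eigenvectorUnitary : Matrix (Fin m) (Fin m) ℂ) with hY
  have hYY : Y * Yᴴ = 1 := Unitary.coe_mul_star_self hH.eigenvectorUnitary
  have hYY' : Yᴴ * Y = 1 := Unitary.coe_star_mul_self hH.eigenvectorUnitary
  have hD : Yᴴ * (M * Mᴴ) * Y = diagonal (fun j => (hH.eigenvalues j : ℂ)) := by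
    have := hH.conjStarAlgAut_star_eigenvectorUnitary
    rw [Unitary.conjStarAlgAut_star_apply] at this
    exact this
  set s : Fin m → ℝ := fun j => √(hH.eigenvalues j) with hs
  have hs2 : ∀ j, (s j : ℂ) * s j = hH.eigenvalues j := fun j => by
    rw [← Complex.ofReal_mul, Real.mul_self_sqrt (hP.eigenvalues_nonneg j)]
  set u : Matrix (Fin n) (Fin m) ℂ := (Yᴴ * M)ᵀ with hu
  have hg : ∀ i j, ∑ k, star (u k i) * u k j = if i = j then (hH.eigenvalues i : ℂ) else 0 := by
    intro i j
    have h1 : Yᴴ * (M * Mᴴ) * Y = (Yᴴ * M) * (Yᴴ * M)ᴴ := by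
      rw [conjTranspose_mul, conjTranspose_conjTranspose]
      simp only [Matrix.mul_assoc]
    have h2 := congrFun (congrFun (h1.symm.trans hD) j) i
    rw [mul_apply, diagonal_apply] at h2
    have h3 : ∑ k, star (u k i) * u k j = ∑ k, (Yᴴ * M) j k * (Yᴴ * M)ᴴ k i := by
      refine Finset.sum_congr rfl fun k _ => ?_
      rw [conjTranspose_apply, hu, transpose_apply, transpose_apply, mul_comm]
    rw [h3, h2]
    by_cases h : i = j
    · simp [h]
    · simp [h, Ne.symm h]
  -- The columns of u are orthogonal with lengths s j. Division normalizes them, and the convention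
  -- 0⁻¹ = 0 makes the column vanish where s does.
  set E : Matrix (Fin n) (Fin m) ℂ := of fun k j => (s j : ℂ)⁻¹ * u k j with hE
  have hEE : Eᴴ * E = diagonal (fun j => if s j = 0 then 0 else 1) := by
    ext i j
    have h1 : (Eᴴ * E) i j = (s i : ℂ)⁻¹ * (s j : ℂ)⁻¹ * ∑ k, star (u k i) * u k j := by
      rw [mul_apply, Finset.mul_sum]
      refine Finset.sum_congr rfl fun k _ => ?_
      rw [conjTranspose_apply, hE, of_apply, of_apply, star_mul', star_inv₀]
      change (starRingEnd ℂ (s i : ℂ))⁻¹ * _ * _ = _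
      rw [Complex.conj_ofReal]
      ring
    rw [h1, hg, diagonal_apply]
    by_cases h : i = j
    · subst h
      rw [if_pos rfl, if_pos rfl, ← hs2]
      by_cases h0 : s i = 0
      · simp [h0]
      · have : (s i : ℂ) ≠ 0 := by exact_mod_cast h0
        rw [if_neg h0]
        field_simp
    · simp [h]
  have hu0 : ∀ j, s j = 0 → ∀ k, u k j = 0 := by
    intro j hj k
    have h1 := hg j j
    rw [if_pos rfl, ← hs2, hj] at h1
    have h2 : ∑ k, ‖u k j‖ ^ 2 = 0 := by
      have : ((∑ k, ‖u k j‖ ^ 2 : ℝ) : ℂ) = 0 := by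
        rw [show (0 : ℂ) = ∑ k, star (u k j) * u k j by rw [h1]; simp, Complex.ofReal_sum]
        refine Finset.sum_congr rfl fun k _ => ?_
        rw [← Complex.normSq_eq_norm_sq, Complex.normSq_eq_conj_mul_self]
        rfl
      exact_mod_cast this
    rw [Finset.sum_eq_zero_iff_of_nonneg fun _ _ => by positivity] at h2
    simpa using h2 k (Finset.mem_univ k)
  refine ⟨Y, E, s, hYY, fun j => Real.sqrt_nonneg _, hEE, ?_, fun i k => ?_⟩
  · rw [hEE]
    ext k j
    rw [mul_diagonal]
    by_cases h0 : s j = 0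
    · simp [hE, h0]
    · simp [h0]
  · have h1 : ∀ j, (s j : ℂ) * (Y i j * E k j) = Y i j * (Yᴴ * M) j k := by
      intro j
      by_cases h0 : s j = 0
      · have := hu0 j h0 k
        rw [hu, transpose_apply] at this
        simp [h0, this]
      · have : (s j : ℂ) ≠ 0 := by exact_mod_cast h0
        rw [hE, of_apply, hu, transpose_apply]
        field_simp
    simp_rw [h1]
    rw [← mul_apply, ← Matrix.mul_assoc, hYY, Matrix.one_mul]

/-! ### Lower bound on unit vectors through the Schmidt form -/

section MinimalEigenvalue

variable {m n : ℕ}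

/-- The vector `∑ⱼ sⱼ |jj⟩`. -/
def schmidtVector (s : Fin m → ℝ) : Fin m × Fin m → ℂ :=
  fun p => if p.1 = p.2 then (s p.1 : ℂ) else 0

theorem schmidtVector_eq_sum (s : Fin m → ℝ) :
    schmidtVector s = ∑ j, (s j : ℂ) • Pi.single (j, j) (1 : ℂ) := by
  ext ⟨i, k⟩
  simp only [schmidtVector, Finset.sum_apply, Pi.smul_apply, Pi.single_apply, Prod.mk.injEq,
    smul_eq_mul, mul_ite, mul_one, mul_zero]
  by_cases h : i = k
  · subst h
    simp
  · rw [if_neg h, Finset.sum_eq_zero]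
    rintro j -
    rw [if_neg]
    rintro ⟨rfl, rfl⟩
    exact h rfl

theorem kronecker_mulVec_schmidtVector (Y : Matrix (Fin m) (Fin m) ℂ)
    (E : Matrix (Fin n) (Fin m) ℂ) (s : Fin m → ℝ) (i : Fin m) (k : Fin n) :
    ((Y ⊗ₖ E) *ᵥ schmidtVector s) (i, k) = ∑ j, (s j : ℂ) * (Y i j * E k j) := by
  rw [schmidtVector_eq_sum, mulVec_sum, Finset.sum_apply]
  refine Finset.sum_congr rfl fun j _ => ?_
  rw [mulVec_smul, mulVec_single_one]
  simp [kroneckerMap_apply]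

theorem dotProduct_schmidtVector (W : BipartiteMatrix m m) (s : Fin m → ℝ) :
    star (schmidtVector s) ⬝ᵥ W *ᵥ schmidtVector s =
      ∑ i, ∑ j, (s i : ℂ) * s j * W (i, i) (j, j) := by
  rw [schmidtVector_eq_sum]
  simp only [star_sum, star_smul, mulVec_sum, mulVec_smul, sum_dotProduct, dotProduct_sum,
    smul_dotProduct, dotProduct_smul, mulVec_single_one, ← Pi.single_star, star_one,
    single_one_dotProduct, smul_eq_mul, col_apply]
  simp only [Finset.mul_sum]
  rw [Finset.sum_comm]
  refine Finset.sum_congr rfl fun i _ => Finset.sum_congr rfl fun j _ => ?_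
  change _ * (starRingEnd ℂ (s i : ℂ) * _) = _
  rw [Complex.conj_ofReal]
  ring

/-- Opposite phases on the two factors make the average pair |ii⟩ with |jj⟩, which is the Schmidt
expectation, and |ik⟩ with itself, which involves only diagonal entries. -/
theorem IsBlockPositive.schmidtVector_bound {W : BipartiteMatrix m m} (hW : IsBlockPositive W)
    {s : Fin m → ℝ} (hs : ∀ j, 0 ≤ s j) (hs1 : ∑ j, s j ^ 2 ≤ 1) :
    -(1 / 2) * W.trace.re ≤ (star (schmidtVector s) ⬝ᵥ W *ᵥ schmidtVector s).re := by
  set r : Fin m → ℂ := fun j => ((√(s j) : ℝ) : ℂ) with hr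
  have hr2 : ∀ j, r j * r j = s j := fun j => by
    simp only [hr]
    rw [← Complex.ofReal_mul, Real.mul_self_sqrt (hs j)]
  have hrs : ∀ j, star (r j) = r j := fun j => Complex.conj_ofReal _
  set F : Fin m → Fin m → Fin m → Fin m → ℂ := fun i j k l =>
    r i * r j * r k * r l * W (i, l) (j, k) with hF
  have h1 := phase_average_nonneg F fun z hz => by
    have h := hW.nonneg (fun i => r i * z i) (fun i => r i * star (z i))
    refine h.trans_eq (congrArg Complex.re ?_)
    rw [dotProduct_productVector]
    refine Finset.sum_congr rfl fun i _ => Finset.sum_congr rfl fun j _ => ?_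
    simp only [dotProduct, mulVec, tensorBlock, of_apply, Finset.mul_sum]
    rw [Finset.sum_comm]
    refine Finset.sum_congr rfl fun k _ => Finset.sum_congr rfl fun l _ => ?_
    simp only [hF, Pi.star_apply, star_mul', hrs, star_star]
    ring
  have h2 : ∑ i, ∑ j, F i j j i = star (schmidtVector s) ⬝ᵥ W *ᵥ schmidtVector s := by
    rw [dotProduct_schmidtVector]
    refine Finset.sum_congr rfl fun i _ => Finset.sum_congr rfl fun j _ => ?_
    rw [← hr2, ← hr2]
    simp only [hF]
    ring
  set w : Fin m → Fin m → ℝ := fun i k => (W (i, k) (i, k)).re with hw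
  have hw0 : ∀ i k, 0 ≤ w i k := fun i k => hW.diag_nonneg (i, k)
  have h3 : ∀ i k, (F i i k k).re = s i * s k * w i k := by
    intro i k
    simp only [hF]
    rw [hr2, mul_assoc (s i : ℂ), hr2, ← Complex.ofReal_mul, Complex.re_ofReal_mul]
  rw [h2, Complex.sub_re, Complex.add_re] at h1
  simp only [Complex.re_sum, h3] at h1
  have h4 : W.trace.re = ∑ i, ∑ k, w i k := by
    simp [trace, Fintype.sum_prod_type, hw]
  -- For i ≠ k, s i · s k ≤ (s i² + s k²)/2 ≤ 1/2; the terms i = k cancel.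
  have h5 : ∑ i, ∑ k, s i * s k * w i k - ∑ i, s i * s i * w i i ≤ 1 / 2 * ∑ i, ∑ k, w i k := by
    rw [← Finset.sum_sub_distrib, Finset.mul_sum]
    refine Finset.sum_le_sum fun i _ => ?_
    rw [← Finset.add_sum_erase _ _ (Finset.mem_univ i), add_sub_cancel_left,
      ← Finset.add_sum_erase _ (fun k => w i k) (Finset.mem_univ i), mul_add, Finset.mul_sum]
    have : ∑ k ∈ Finset.univ.erase i, s i * s k * w i k ≤
        ∑ k ∈ Finset.univ.erase i, 1 / 2 * w i k := by
      refine Finset.sum_le_sum fun k hk => mul_le_mul_of_nonneg_right ?_ (hw0 i k)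
      have hik : i ≠ k := (Finset.ne_of_mem_erase hk).symm
      have : s i ^ 2 + s k ^ 2 ≤ 1 := by
        refine le_trans ?_ hs1
        rw [← Finset.sum_pair (f := fun k => s k ^ 2) hik]
        exact Finset.sum_le_sum_of_subset_of_nonneg (Finset.subset_univ _)
          fun _ _ _ => by positivity
      nlinarith [sq_nonneg (s i - s k)]
    have := hw0 i i
    linarith
  linarith

/-- A block-positive matrix is bounded below by `-tr W / 2` on unit vectors. -/
theorem IsBlockPositive.neg_half_trace_le {W : BipartiteMatrix m n} (hW : IsBlockPositive W)
    {ψ : Fin m × Fin n → ℂ} (hψ : star ψ ⬝ᵥ ψ = 1) :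
    -(1 / 2) * W.trace.re ≤ (star ψ ⬝ᵥ W *ᵥ ψ).re := by
  obtain ⟨Y, E, s, hY, hs, hE, hE', hM⟩ :=
    exists_singular_value_decomposition (of fun i k => ψ (i, k))
  have hψ' : (Y ⊗ₖ E) *ᵥ schmidtVector s = ψ := by
    ext ⟨i, k⟩
    rw [kronecker_mulVec_schmidtVector, ← hM, of_apply]
  have hYY : Yᴴ * Y = 1 := mul_eq_one_comm.1 hY
  have hs1 : ∑ j, s j ^ 2 = 1 := by
    have h1 := dotProduct_conj_mulVec 1 (Y ⊗ₖ E) (schmidtVector s) (schmidtVector s)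
    rw [hψ', one_mulVec, hψ, Matrix.mul_one, conjTranspose_kronecker, ← mul_kronecker_mul, hYY,
      hE, dotProduct_schmidtVector] at h1
    simp only [kroneckerMap_apply, one_apply, diagonal_apply] at h1
    have h2 : ((∑ j, s j ^ 2 : ℝ) : ℂ) = 1 := by
      rw [← h1, Complex.ofReal_sum]
      refine Finset.sum_congr rfl fun i _ => ?_
      rw [Finset.sum_eq_single i (by intro j _ hj; simp [hj.symm]) (by simp)]
      by_cases h0 : s i = 0
      · simp [h0]
      · simp [h0, sq]
    exact_mod_cast h2
  -- At the Schmidt vector the filtered matrix takes the value ⟨ψ|W|ψ⟩, and its trace is at most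
  -- that of W.
  have h1 := (hW.localConj Y E).schmidtVector_bound hs hs1.le
  rw [dotProduct_conj_mulVec, hψ'] at h1
  have h2 := hW.trace_localConj_le hY hE'
  linarith

end MinimalEigenvalue

/-! ### Finer witnesses and a criterion for optimality -/

section Optimality

variable {m n : ℕ}

theorem trace_mul_vecMulVec_star {ι : Type*} [Fintype ι] (W : Matrix ι ι ℂ) (x : ι → ℂ) :
    (W * vecMulVec x (star x)).trace = star x ⬝ᵥ W *ᵥ x := by
  rw [mul_vecMulVec, trace_vecMulVec, dotProduct_comm]

theorem vecMulVec_kronecker_vecMulVec (v : Fin m → ℂ) (w : Fin n → ℂ) :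
    vecMulVec v (star v) ⊗ₖ vecMulVec w (star w) =
      vecMulVec (productVector v w) (star (productVector v w)) := by
  ext ⟨i, k⟩ ⟨j, l⟩
  simp only [kroneckerMap_apply, vecMulVec_apply, Pi.star_apply, productVector, star_mul']
  ring

theorem IsBlockPositive.trace_mul_nonneg_of_separable {W ρ : BipartiteMatrix m n}
    (hW : IsBlockPositive W) (hρ : IsSeparableState ρ) : 0 ≤ (W * ρ).trace.re := by
  obtain ⟨N, p, v, w, hp, -, -, -, rfl⟩ := hρ
  simp only [Matrix.mul_sum, trace_sum, Complex.re_sum, mul_smul_comm, trace_smul, smul_eq_mul,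
    Complex.re_ofReal_mul, vecMulVec_kronecker_vecMulVec, trace_mul_vecMulVec_star]
  exact Finset.sum_nonneg fun i _ => mul_nonneg (hp i) (hW.nonneg _ _)

theorem Matrix.IsHermitian.trace_eq_re {ι : Type*} [Fintype ι] {A : Matrix ι ι ℂ}
    (hA : A.IsHermitian) : A.trace = (A.trace.re : ℂ) := by
  refine (Complex.conj_eq_iff_re.1 ?_).symm
  change star _ = _
  rw [← trace_conjTranspose, hA.eq]

theorem Matrix.IsHermitian.trace_mul_self {ι : Type*} [Fintype ι] {A : Matrix ι ι ℂ}
    (hA : A.IsHermitian) : (A * A).trace = ((∑ i, ∑ j, ‖A i j‖ ^ 2 : ℝ) : ℂ) := by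
  simp only [trace, diag_apply, mul_apply, Complex.ofReal_sum]
  refine Finset.sum_congr rfl fun i _ => Finset.sum_congr rfl fun j _ => ?_
  rw [← hA.apply j i, ← Complex.normSq_eq_norm_sq, ← Complex.mul_conj]
  rfl

/-- Zero trace would force tr W² = 0 by the purity bound, hence W = 0, which has no negative
eigenvalue. -/
theorem IsEntanglementWitness.trace_pos {W : BipartiteMatrix m n} (hW : IsEntanglementWitness W) :
    0 < W.trace.re := by
  refine lt_of_le_of_ne hW.toIsBlockPositive.trace_nonneg fun h0 => ?_
  have h1 := hW.toIsBlockPositive.trace_mul_self_le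
  rw [hW.isHermitian.trace_eq_re, ← h0, hW.isHermitian.trace_mul_self, Complex.ofReal_re] at h1
  have h2 : W = 0 := by
    ext i j
    have h3 : ∑ i, ∑ j, ‖W i j‖ ^ 2 = 0 :=
      le_antisymm (by simpa using h1) (by positivity)
    rw [Finset.sum_eq_zero_iff_of_nonneg fun _ _ => by positivity] at h3
    have h4 := h3 i (Finset.mem_univ i)
    rw [Finset.sum_eq_zero_iff_of_nonneg fun _ _ => by positivity] at h4
    simpa using h4 j (Finset.mem_univ j)
  obtain ⟨i, hi⟩ := hW.exists_neg
  subst h2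
  rw [hW.isHermitian.eigenvalues_eq] at hi
  simp at hi

/-- If `W₁` is finer than `W`, then some nonnegative combination `α W - β W₁` with `α > 0` is
positive semidefinite. -/
theorem IsFiner.exists_posSemidef {W W₁ : BipartiteMatrix m n} (hW : IsEntanglementWitness W)
    (hW₁ : IsEntanglementWitness W₁) (h : IsFiner W₁ W) :
    ∃ α β : ℝ, 0 < α ∧ 0 ≤ β ∧
      ∀ ρ : BipartiteMatrix m n, ρ.PosSemidef →
        0 ≤ α * (W * ρ).trace.re - β * (W₁ * ρ).trace.re := by
  -- K records the pairs of expectation values over the positive cone. That W₁ is finer says that K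
  -- misses the open quadrant U.
  set K : Set (ℝ × ℝ) := (fun ρ : BipartiteMatrix m n => ((W * ρ).trace.re, (W₁ * ρ).trace.re)) ''
    {ρ | ρ.PosSemidef} with hK
  set U : Set (ℝ × ℝ) := Set.Iio 0 ×ˢ Set.Ioi 0 with hU
  have hKc : Convex ℝ K := by
    rintro _ ⟨ρ, hρ, rfl⟩ _ ⟨σ, hσ, rfl⟩ a b ha hb -
    refine ⟨(a : ℂ) • ρ + (b : ℂ) • σ, ?_, ?_⟩
    · exact (hρ.smul (by exact_mod_cast ha)).add (hσ.smul (by exact_mod_cast hb))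
    · simp [Matrix.mul_add, trace_add]
  have hdisj : Disjoint U K := by
    rw [Set.disjoint_left]
    rintro _ ⟨h1, h2⟩ ⟨ρ, hρ, rfl⟩
    simp only [Set.mem_Iio, Set.mem_Ioi] at h1 h2
    have hρ0 : ρ ≠ 0 := by
      rintro rfl
      simp at h1
    have ht : 0 < ρ.trace.re := by
      have h3 := hρ.trace_nonneg
      have h4 : ρ.trace ≠ 0 := fun h5 => hρ0 (hρ.trace_eq_zero_iff.1 h5)
      rw [hρ.isHermitian.trace_eq_re] at h3 h4
      exact lt_of_le_of_ne (by exact_mod_cast h3) fun h5 => h4 (by rw [← h5]; simp)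
    set t := ρ.trace.re with htdef
    have key : ∀ V : BipartiteMatrix m n, (V * ((t⁻¹ : ℝ) : ℂ) • ρ).trace.re =
        t⁻¹ * (V * ρ).trace.re := fun V => by
      rw [mul_smul_comm, trace_smul, smul_eq_mul, Complex.re_ofReal_mul]
    have hs : ((t⁻¹ : ℝ) : ℂ) • ρ ∈ detectedStates W := by
      have hneg : (W * ((t⁻¹ : ℝ) : ℂ) • ρ).trace.re < 0 := by
        rw [key]
        exact mul_neg_of_pos_of_neg (inv_pos.2 ht) h1
      refine ⟨⟨hρ.smul (by exact_mod_cast (inv_pos.2 ht).le), ?_⟩, fun hsep => ?_, hneg⟩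
      · rw [trace_smul, hρ.isHermitian.trace_eq_re, ← htdef, smul_eq_mul, ← Complex.ofReal_mul,
          inv_mul_cancel₀ ht.ne', Complex.ofReal_one]
      · exact hneg.not_ge (hW.toIsBlockPositive.trace_mul_nonneg_of_separable hsep)
    have h3 := (h hs).2.2
    rw [key] at h3
    exact h3.not_ge (mul_nonneg (inv_pos.2 ht).le h2.le)
  obtain ⟨f, u, hf1, hf2⟩ := geometric_hahn_banach_open
    ((convex_Iio 0).prod (convex_Ioi 0)) (isOpen_Iio.prod isOpen_Ioi) hKc hdisj
  set α := f (1, 0) with hα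
  set β := f (0, 1) with hβ
  have hf : ∀ x y : ℝ, f (x, y) = α * x + β * y := by
    intro x y
    have : (x, y) = x • ((1, 0) : ℝ × ℝ) + y • ((0, 1) : ℝ × ℝ) := by simp
    rw [this, map_add, map_smul, map_smul, smul_eq_mul, smul_eq_mul]
    ring
  have hA : ∀ x y : ℝ, 0 < x → 0 < y → α * -x + β * y < u := fun x y hx hy => by
    rw [← hf]
    exact hf1 _ ⟨by simpa using hx, hy⟩
  have hB : ∀ ρ : BipartiteMatrix m n, ρ.PosSemidef →
      u ≤ α * (W * ρ).trace.re + β * (W₁ * ρ).trace.re := fun ρ hρ => by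
    rw [← hf]
    exact hf2 _ ⟨ρ, hρ, rfl⟩
  have hu : u ≤ 0 := by simpa using hB 0 PosSemidef.zero
  -- K is a cone, so a functional bounded below on it is nonnegative there.
  have hC : ∀ ρ : BipartiteMatrix m n, ρ.PosSemidef →
      0 ≤ α * (W * ρ).trace.re + β * (W₁ * ρ).trace.re := by
    intro ρ hρ
    by_contra! hneg
    set g := α * (W * ρ).trace.re + β * (W₁ * ρ).trace.re with hg
    have hN : 0 ≤ (u - 1) / g := div_nonneg_of_nonpos (by linarith) hneg.le
    have h1 := hB ((((u - 1) / g : ℝ) : ℂ) • ρ) (hρ.smul (by exact_mod_cast hN))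
    simp only [mul_smul_comm, trace_smul, smul_eq_mul, Complex.re_ofReal_mul] at h1
    have h2 : α * ((u - 1) / g * (W * ρ).trace.re) + β * ((u - 1) / g * (W₁ * ρ).trace.re) =
        (u - 1) / g * g := by
      rw [hg]
      ring
    rw [h2, div_mul_cancel₀ _ hneg.ne] at h1
    linarith
  have hα0 : 0 ≤ α := by
    by_contra! hneg
    have h1 := hA ((|β| + 1) / -α) 1 (div_pos (by positivity) (by linarith)) one_pos
    have h2 : α * -((|β| + 1) / -α) = |β| + 1 := by
      field_simp
      exact div_self hneg.ne
    rw [h2] at h1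
    linarith [neg_abs_le β]
  have hβ0 : β ≤ 0 := by
    by_contra! hpos
    have h1 := hA 1 ((|α| + 1) / β) one_pos (div_pos (by positivity) hpos)
    rw [mul_div_cancel₀ _ hpos.ne'] at h1
    linarith [le_abs_self α]
  refine ⟨α, -β, lt_of_le_of_ne hα0 fun h0 => ?_, by linarith, fun ρ hρ => by
    have := hC ρ hρ
    linarith⟩
  -- If α = 0, testing on the identity gives β · tr W₁ ≥ 0, so β ≥ 0, against β < u ≤ 0.
  have h1 := hC 1 PosSemidef.one
  have h2 := hA 1 1 one_pos one_pos
  rw [← h0] at h1 h2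
  rw [Matrix.mul_one, Matrix.mul_one] at h1
  have h3 := hW₁.trace_pos
  nlinarith

/-- A witness of trace one attaining the minimum of a positive semidefinite functional over all
block-positive matrices of trace one is optimal. -/
theorem IsEntanglementWitness.isOptimalWitness_of_extremal {W : BipartiteMatrix m n}
    (hW : IsEntanglementWitness W) (htr : W.trace = 1) {Q : BipartiteMatrix m n}
    (hQ : Q.PosSemidef) {κ : ℝ} (hκ : 0 < κ)
    (hmin : ∀ W₁ : BipartiteMatrix m n, IsBlockPositive W₁ → W₁.trace = 1 →
      -κ ≤ (W₁ * Q).trace.re) (hWQ : (W * Q).trace.re = -κ) : IsOptimalWitness W := by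
  refine ⟨hW, fun W₁ hW₁ hfin => ?_⟩
  obtain ⟨α, β, hα, hβ, hpos⟩ := hfin.exists_posSemidef hW hW₁
  set t := W₁.trace.re with ht
  have ht0 : 0 < t := hW₁.trace_pos
  have hmin1 : -κ * t ≤ (W₁ * Q).trace.re := by
    have hbp : IsBlockPositive (((t⁻¹ : ℝ) : ℂ) • W₁) :=
      ⟨by
        rw [IsHermitian, conjTranspose_smul, hW₁.isHermitian.eq]
        congr 1
        exact Complex.conj_ofReal _, fun a b => by
        rw [smul_mulVec, dotProduct_smul, smul_eq_mul, Complex.re_ofReal_mul]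
        exact mul_nonneg (inv_pos.2 ht0).le (hW₁.nonneg a b)⟩
    have h1 := hmin _ hbp (by
      rw [trace_smul, hW₁.isHermitian.trace_eq_re, ← ht, smul_eq_mul, ← Complex.ofReal_mul,
        inv_mul_cancel₀ ht0.ne', Complex.ofReal_one])
    rw [smul_mul_assoc, trace_smul, smul_eq_mul, Complex.re_ofReal_mul] at h1
    have h2 := mul_le_mul_of_nonneg_right h1 ht0.le
    rwa [mul_right_comm, inv_mul_cancel₀ ht0.ne', one_mul] at h2
  -- Testing on Q compares the value -κ for W with the lower bound -κt for W₁.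
  have hle : α ≤ β * t := by
    have h1 := hpos Q hQ
    rw [hWQ] at h1
    have h2 := mul_le_mul_of_nonneg_left hmin1 hβ
    by_contra! h3
    nlinarith [mul_lt_mul_of_pos_right h3 hκ]
  set P : BipartiteMatrix m n := (α : ℂ) • W - (β : ℂ) • W₁ with hP
  have hPtr : ∀ ρ : BipartiteMatrix m n, (P * ρ).trace.re =
      α * (W * ρ).trace.re - β * (W₁ * ρ).trace.re := fun ρ => by
    rw [hP, sub_mul, smul_mul_assoc, smul_mul_assoc, trace_sub, trace_smul, trace_smul,
      Complex.sub_re, smul_eq_mul, smul_eq_mul, Complex.re_ofReal_mul, Complex.re_ofReal_mul]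
  have hPH : P.IsHermitian := by
    rw [IsHermitian, hP, conjTranspose_sub, conjTranspose_smul, conjTranspose_smul,
      hW.isHermitian.eq, hW₁.isHermitian.eq]
    congr 2 <;> exact Complex.conj_ofReal _
  have hPP : P.PosSemidef := by
    refine PosSemidef.of_dotProduct_mulVec_nonneg hPH fun x => ?_
    rw [Complex.le_def]
    refine ⟨?_, (hPH.im_star_dotProduct_mulVec_self _).symm⟩
    rw [← trace_mul_vecMulVec_star, hPtr]
    exact hpos _ (posSemidef_vecMulVec_self_star x)
  -- The trace of P is α - βt ≤ 0, whereas a positive semidefinite matrix has trace at least zero,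
  -- with equality only for 0.
  have hP0 : P = 0 := by
    rw [← hPP.trace_eq_zero_iff, hPH.trace_eq_re]
    have h1 := hPtr 1
    simp only [Matrix.mul_one, htr, Complex.one_re, ← ht] at h1
    have h2 := (Complex.le_def.1 hPP.trace_nonneg).1
    rw [Complex.zero_re] at h2
    have : P.trace.re = 0 := le_antisymm (by linarith) h2
    rw [this, Complex.ofReal_zero]
  have hβ0 : 0 < β := lt_of_le_of_ne hβ fun h0 => by
    rw [← h0, zero_mul] at hle
    linarith
  refine ⟨α / β, div_pos hα hβ0, ?_⟩
  rw [hP, sub_eq_zero] at hP0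
  rw [Complex.ofReal_div, div_eq_inv_mul, mul_smul, hP0, smul_smul, inv_mul_cancel₀, one_smul]
  exact_mod_cast hβ0.ne'

end Optimality

theorem dotProduct_mul_dotProduct_star {ι : Type*} [Fintype ι] (x y : ι → ℂ) :
    (star x ⬝ᵥ y) * (star y ⬝ᵥ x) = ((‖star y ⬝ᵥ x‖ ^ 2 : ℝ) : ℂ) := by
  rw [star_dotProduct x y, ← Complex.normSq_eq_norm_sq, Complex.normSq_eq_conj_mul_self]
  rfl

/-! ### Sorted eigenvalues with an orthonormal eigenbasis -/

section SortedSpectrum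

variable {m n : ℕ}

/-- The eigenvalues of a Hermitian matrix in decreasing order, together with a matching
orthonormal basis of eigenvectors. -/
structure SortedEigenbasis (W : BipartiteMatrix m n) (μ : Fin (m * n) → ℝ)
    (w : Fin (m * n) → Fin m × Fin n → ℂ) : Prop where
  antitone : Antitone μ
  orthonormal : ∀ k l, star (w k) ⬝ᵥ w l = if k = l then 1 else 0
  parseval : ∀ x y, ∑ k, (star x ⬝ᵥ w k) * (star (w k) ⬝ᵥ y) = star x ⬝ᵥ y
  eigen : ∀ k, W *ᵥ w k = (μ k : ℂ) • w k

theorem Matrix.IsHermitian.exists_sortedEigenbasis {W : BipartiteMatrix m n}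
    (hW : W.IsHermitian) :
    ∃ (μ : Fin (m * n) → ℝ) (w : Fin (m * n) → Fin m × Fin n → ℂ), SortedEigenbasis W μ w ∧
      (∀ k : Fin (m * n), sortedEigenvalue hW (k + 1) = μ k) ∧
      (∀ i, ∃ k, hW.eigenvalues i = μ k) := by
  have hd : m * n = Fintype.card (Fin m × Fin n) := by simp
  set e : Fin (Fintype.card (Fin m × Fin n)) ≃ Fin m × Fin n :=
    Fintype.equivOfCardEq (Fintype.card_fin _) with he
  set e' : Fin (m * n) ≃ Fin m × Fin n := (finCongr hd).trans e with he'
  have hev : ∀ k, hW.eigenvalues (e' k) = hW.eigenvalues₀ (Fin.cast hd k) := by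
    intro k
    rw [IsHermitian.eigenvalues, he', Equiv.trans_apply, ← he, Equiv.symm_apply_apply]
    rfl
  have hin : ∀ x y : EuclideanSpace ℂ (Fin m × Fin n), inner ℂ x y = star x.ofLp ⬝ᵥ y.ofLp := by
    intro x y
    rw [EuclideanSpace.inner_eq_star_dotProduct, dotProduct_comm]
  refine ⟨fun k => hW.eigenvalues (e' k), fun k => (hW.eigenvectorBasis (e' k)).ofLp,
    ⟨?_, ?_, ?_, ?_⟩, ?_, ?_⟩
  · intro k l hkl
    simp only [hev]
    exact hW.eigenvalues₀_antitone hkl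
  · intro k l
    rw [← hin, orthonormal_iff_ite.1 hW.eigenvectorBasis.orthonormal]
    simp
  · intro x y
    have h := hW.eigenvectorBasis.sum_inner_mul_inner (WithLp.toLp 2 x) (WithLp.toLp 2 y)
    simp only [hin] at h
    rw [← h]
    exact Equiv.sum_comp e' fun i => (star x ⬝ᵥ (hW.eigenvectorBasis i).ofLp) *
      (star (hW.eigenvectorBasis i).ofLp ⬝ᵥ y)
  · intro k
    rw [hW.mulVec_eigenvectorBasis]
    ext p
    simp
  · intro k
    have hk := k.isLt
    rw [sortedEigenvalue, dif_pos ⟨by omega, by omega⟩]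
    exact (hev k).symm
  · intro i
    exact ⟨e'.symm i, by simp⟩

namespace SortedEigenbasis

variable {W : BipartiteMatrix m n} {μ : Fin (m * n) → ℝ} {w : Fin (m * n) → Fin m × Fin n → ℂ}

theorem dotProduct_mulVec (h : SortedEigenbasis W μ w) (hW : W.IsHermitian) (k : Fin (m * n))
    (x : Fin m × Fin n → ℂ) : star (w k) ⬝ᵥ W *ᵥ x = μ k * (star (w k) ⬝ᵥ x) := by
  rw [Matrix.dotProduct_mulVec, ← hW.eq, ← star_mulVec, h.eigen, star_smul, smul_dotProduct,
    smul_eq_mul]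
  congr 1
  exact Complex.conj_ofReal _

theorem self_dotProduct (h : SortedEigenbasis W μ w) (x : Fin m × Fin n → ℂ) :
    (star x ⬝ᵥ x).re = ∑ k, ‖star (w k) ⬝ᵥ x‖ ^ 2 := by
  rw [← h.parseval, Complex.re_sum]
  refine Finset.sum_congr rfl fun k _ => ?_
  rw [dotProduct_mul_dotProduct_star, Complex.ofReal_re]

theorem quadraticForm (h : SortedEigenbasis W μ w) (hW : W.IsHermitian)
    (x : Fin m × Fin n → ℂ) :
    (star x ⬝ᵥ W *ᵥ x).re = ∑ k, μ k * ‖star (w k) ⬝ᵥ x‖ ^ 2 := by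
  rw [← h.parseval, Complex.re_sum]
  refine Finset.sum_congr rfl fun k _ => ?_
  rw [h.dotProduct_mulVec hW, mul_left_comm, dotProduct_mul_dotProduct_star,
    ← Complex.ofReal_mul, Complex.ofReal_re]

theorem trace_mul_eq (h : SortedEigenbasis W μ w) (A : BipartiteMatrix m n) :
    A.trace = ∑ k, star (w k) ⬝ᵥ A *ᵥ w k := by
  have h1 : ∀ p, A p p = ∑ k, (A *ᵥ w k) p * star (w k p) := by
    intro p
    have := h.parseval (star (A p)) (Pi.single p 1)
    simp only [star_star, dotProduct_single_one] at this
    simpa [mulVec] using this.symm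
  simp only [trace, diag_apply, h1]
  rw [Finset.sum_comm]
  refine Finset.sum_congr rfl fun k _ => ?_
  rw [dotProduct_comm]
  rfl

theorem quadraticForm_self (h : SortedEigenbasis W μ w) (k : Fin (m * n)) :
    star (w k) ⬝ᵥ W *ᵥ w k = μ k := by
  rw [h.eigen, dotProduct_smul, h.orthonormal]
  simp

theorem trace_eq (h : SortedEigenbasis W μ w) : W.trace = ((∑ k, μ k : ℝ) : ℂ) := by
  rw [h.trace_mul_eq, Complex.ofReal_sum]
  exact Finset.sum_congr rfl fun k _ => h.quadraticForm_self k

theorem trace_mul_self_eq (h : SortedEigenbasis W μ w) :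
    (W * W).trace = ((∑ k, μ k ^ 2 : ℝ) : ℂ) := by
  rw [h.trace_mul_eq, Complex.ofReal_sum]
  refine Finset.sum_congr rfl fun k _ => ?_
  rw [← mulVec_mulVec, h.eigen, mulVec_smul, dotProduct_smul, h.quadraticForm_self]
  simp [sq]

end SortedEigenbasis

end SortedSpectrum

/-! ### Spectral inequalities and optimality of extremal witnesses -/

section Spectrum

variable {m n : ℕ} {W : BipartiteMatrix m n} {μ : Fin (m * n) → ℝ}
  {w : Fin (m * n) → Fin m × Fin n → ℂ}

/-- The numbers other than μ j sum to more than one; Cauchy–Schwarz bounds their squares. -/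
theorem one_div_lt_sum_sq {ι : Type*} [Fintype ι] [DecidableEq ι] {μ : ι → ℝ}
    (h1 : ∑ k, μ k = 1) {j : ι} (hj : μ j < 0) :
    1 / ((Fintype.card ι : ℝ) - 1) < ∑ k, μ k ^ 2 := by
  have h2 : 1 < ∑ k ∈ Finset.univ.erase j, μ k := by
    have := Finset.add_sum_erase Finset.univ μ (Finset.mem_univ j)
    linarith
  have hc : ((Finset.univ.erase j).card : ℝ) = (Fintype.card ι : ℝ) - 1 := by
    rw [Finset.card_erase_of_mem (Finset.mem_univ j), Finset.card_univ,
      Nat.cast_sub (Fintype.card_pos_iff.2 ⟨j⟩), Nat.cast_one]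
  have h3 := sq_sum_le_card_mul_sum_sq (s := Finset.univ.erase j) (f := μ)
  have h4 : ∑ k ∈ Finset.univ.erase j, μ k ^ 2 ≤ ∑ k, μ k ^ 2 :=
    Finset.sum_le_sum_of_subset_of_nonneg (Finset.erase_subset _ _) fun _ _ _ => sq_nonneg _
  rw [hc] at h3
  have h5 : 1 < ((Fintype.card ι : ℝ) - 1) * ∑ k ∈ Finset.univ.erase j, μ k ^ 2 := by nlinarith
  have h6 : 0 < (Fintype.card ι : ℝ) - 1 := by
    by_contra! h
    have : 0 ≤ ∑ k ∈ Finset.univ.erase j, μ k ^ 2 := Finset.sum_nonneg fun _ _ => sq_nonneg _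
    nlinarith
  rw [div_lt_iff₀ h6]
  nlinarith

theorem one_div_lt_of_forall_le {ι : Type*} [Fintype ι] [DecidableEq ι] {μ : ι → ℝ}
    (h1 : ∑ k, μ k = 1) {j : ι} (hj : μ j < 0) {M : ℝ} (hM : ∀ k, μ k ≤ M) :
    1 / ((Fintype.card ι : ℝ) - 1) < M := by
  have h2 : 1 < ∑ k ∈ Finset.univ.erase j, μ k := by
    have := Finset.add_sum_erase Finset.univ μ (Finset.mem_univ j)
    linarith
  have hc : ((Finset.univ.erase j).card : ℝ) = (Fintype.card ι : ℝ) - 1 := by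
    rw [Finset.card_erase_of_mem (Finset.mem_univ j), Finset.card_univ,
      Nat.cast_sub (Fintype.card_pos_iff.2 ⟨j⟩), Nat.cast_one]
  have h3 := Finset.sum_le_card_nsmul (Finset.univ.erase j) μ M fun k _ => hM k
  rw [nsmul_eq_mul, hc] at h3
  have h6 : 0 < (Fintype.card ι : ℝ) - 1 := by
    refine lt_of_le_of_ne ?_ fun h => ?_
    · rw [← hc]
      positivity
    · rw [← h, zero_mul] at h3
      linarith
  rw [div_lt_iff₀ h6]
  linarith

/-- An eigenvalue `-1/2` makes a witness of trace one optimal. -/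
theorem IsEntanglementWitness.isOptimalWitness_of_eigenvalue (hW : IsEntanglementWitness W)
    (htr : W.trace = 1) {ψ : Fin m × Fin n → ℂ} (hψ : star ψ ⬝ᵥ ψ = 1)
    (h : (star ψ ⬝ᵥ W *ᵥ ψ).re = -(1 / 2)) : IsOptimalWitness W := by
  refine hW.isOptimalWitness_of_extremal htr (posSemidef_vecMulVec_self_star ψ)
    (κ := 1 / 2) (by norm_num) (fun W₁ h₁ htr₁ => ?_) ?_
  · rw [trace_mul_vecMulVec_star]
    have := h₁.neg_half_trace_le hψ
    rwa [htr₁, Complex.one_re, mul_one] at this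
  · rw [trace_mul_vecMulVec_star, h]

/-- Cauchy-Schwarz for block-positive matrices of trace one. -/
theorem IsBlockPositive.trace_mul_le_one {W₁ : BipartiteMatrix m n} (hW : IsBlockPositive W)
    (hW₁ : IsBlockPositive W₁) (h : W.trace = 1) (h₁ : W₁.trace = 1) :
    (W₁ * W).trace.re ≤ 1 := by
  -- Expand tr (W - W₁)² ≥ 0; both squares have trace at most one by the purity bound.
  have hH : (W - W₁).IsHermitian := hW.isHermitian.sub hW₁.isHermitian
  have e := congrArg Complex.re hH.trace_mul_self
  rw [Complex.ofReal_re] at e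
  have e0 : 0 ≤ ((W - W₁) * (W - W₁)).trace.re := by
    rw [e]
    positivity
  have a := hW.trace_mul_self_le
  have b := hW₁.trace_mul_self_le
  rw [h] at a
  rw [h₁] at b
  simp only [mul_one, Complex.one_re] at a b
  rw [sub_mul, mul_sub, mul_sub, trace_sub, trace_sub, trace_sub, trace_mul_comm W W₁] at e0
  simp only [Complex.sub_re] at e0
  linarith

/-- Since mW is an involution, A = 1 - mW satisfies A² = 2A and is positive semidefinite.
Cauchy–Schwarz gives tr(W₁A) ≥ 1 - m for every competitor, attained at W. -/
theorem IsEntanglementWitness.isOptimalWitness_of_mul_self {W : BipartiteMatrix m m}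
    (hW : IsEntanglementWitness W) (hm : 1 < m) (htr : W.trace = 1)
    (h : W * W = (((m : ℝ)⁻¹ ^ 2 : ℝ) : ℂ) • (1 : BipartiteMatrix m m)) : IsOptimalWitness W := by
  have hm0 : (0 : ℝ) < m := by positivity
  have hm1 : (1 : ℝ) < m := by exact_mod_cast hm
  set A : BipartiteMatrix m m := 1 - ((m : ℝ) : ℂ) • W with hA
  have hAH : A.IsHermitian := by
    rw [IsHermitian, hA, conjTranspose_sub, conjTranspose_smul, conjTranspose_one,
      hW.isHermitian.eq]
    congr 2
    exact Complex.conj_ofReal _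
  have hAA : A * A = (2 : ℂ) • A := by
    rw [hA, sub_mul, mul_sub, mul_sub, Matrix.one_mul, Matrix.mul_one, Matrix.one_mul,
      smul_mul_smul_comm, h, smul_smul, ← Complex.ofReal_mul, ← Complex.ofReal_mul]
    rw [show (m : ℝ) * m * (m : ℝ)⁻¹ ^ 2 = 1 by field_simp, Complex.ofReal_one, one_smul]
    module
  have hAP : A.PosSemidef := by
    have h1 : A = ((2 : ℝ)⁻¹ : ℂ) • (Aᴴ * A) := by
      rw [hAH.eq, hAA, smul_smul]
      norm_num
    rw [h1]
    refine (posSemidef_conjTranspose_mul_self A).smul ?_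
    rw [← Complex.ofReal_inv]
    exact_mod_cast (by norm_num : (0 : ℝ) ≤ 2⁻¹)
  have key : ∀ W₁ : BipartiteMatrix m m, W₁.trace = 1 →
      (W₁ * A).trace.re = 1 - m * (W₁ * W).trace.re := fun W₁ h₁ => by
    rw [hA, mul_sub, Matrix.mul_one, trace_sub, mul_smul_comm, trace_smul, smul_eq_mul,
      Complex.sub_re, Complex.re_ofReal_mul, h₁, Complex.one_re]
  refine hW.isOptimalWitness_of_extremal htr hAP (κ := m - 1) (by linarith)
    (fun W₁ hb h₁ => ?_) ?_
  · rw [key W₁ h₁]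
    have := hW.toIsBlockPositive.trace_mul_le_one hb htr h₁
    nlinarith
  · rw [key W htr, h, trace_smul, trace_one, smul_eq_mul, Complex.re_ofReal_mul]
    simp only [Fintype.card_prod, Fintype.card_fin, Nat.cast_mul, Complex.mul_re,
      Complex.natCast_re, Complex.natCast_im, mul_zero, sub_zero]
    field_simp
    ring

end Spectrum

/-- Eigenvalues are numbered from one, `Fin d` from zero: ranks above a are the indices at least a.
-/
theorem sum_Icc_eq_sum_fin {M : Type*} [AddCommMonoid M] {d a : ℕ} (f : ℕ → M) (g : Fin d → M)
    (h : ∀ k : Fin d, f (k + 1) = g k) :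
    ∑ k ∈ Finset.Icc (a + 1) d, f k = ∑ k ∈ Finset.univ.filter (fun k : Fin d => a ≤ (k : ℕ)), g k := by
  symm
  refine Finset.sum_bij (fun k _ => (k : ℕ) + 1) ?_ ?_ ?_ ?_
  · intro k hk
    have := k.isLt
    simp only [Finset.mem_filter, Finset.mem_univ, true_and] at hk
    simp only [Finset.mem_Icc]
    omega
  · intro k _ l _ hkl
    exact Fin.ext (by omega)
  · intro b hb
    simp only [Finset.mem_Icc] at hb
    exact ⟨⟨b - 1, by omega⟩, by simp; omega, by simp; omega⟩
  · intro k _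
    exact (h k).symm

theorem card_filter_Icc_eq {d : ℕ} (f : ℕ → ℝ) (g : Fin d → ℝ)
    (h : ∀ k : Fin d, f (k + 1) = g k) (c : ℝ) :
    ((Finset.Icc 1 d).filter (fun k => f k = c)).card =
      (Finset.univ.filter (fun k => g k = c)).card := by
  rw [Finset.card_filter, Finset.card_filter]
  have := sum_Icc_eq_sum_fin (a := 0) (fun k => if f k = c then 1 else 0)
    (fun k => if g k = c then 1 else 0) (fun k => by simp only [h])
  rw [zero_add] at this
  rw [this]
  simp

/-! ### Trace norm and negativity -/

section Negativity

variable {m : ℕ} {W : BipartiteMatrix m m}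

theorem sum_eigenvalues_conjTranspose_mul_self {ι : Type*} [Fintype ι] [DecidableEq ι]
    (A : Matrix ι ι ℂ) :
    ∑ i, (isHermitian_conjTranspose_mul_self A).eigenvalues i = (Aᴴ * A).trace.re := by
  rw [(isHermitian_conjTranspose_mul_self A).trace_eq_sum_eigenvalues]
  simp

/-- There are m² singular values, so the constants m⁻² add up to one. Nonnegativity of the left side
bounds the trace norm; its vanishing settles the equality case. -/
theorem sum_sq_sqrt_eigenvalues_sub (hW : IsBlockPositive W) (hm : 0 < m) :
    ∑ i, (√((isHermitian_conjTranspose_mul_self W).eigenvalues i) - (m : ℝ)⁻¹) ^ 2 =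
      (W * W).trace.re - 2 * (m : ℝ)⁻¹ * traceNorm W + 1 := by
  have h0 := (sum_eigenvalues_conjTranspose_mul_self W).trans
    (congrArg (fun A => (A * W).trace.re) hW.isHermitian.eq)
  have h1 : ∀ i, (√((isHermitian_conjTranspose_mul_self W).eigenvalues i) - (m : ℝ)⁻¹) ^ 2 =
      (isHermitian_conjTranspose_mul_self W).eigenvalues i -
      2 * (m : ℝ)⁻¹ * √((isHermitian_conjTranspose_mul_self W).eigenvalues i) + (m : ℝ)⁻¹ ^ 2 :=
    fun i => by
      have := Real.sq_sqrt (eigenvalues_conjTranspose_mul_self_nonneg W i)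
      linear_combination this
  have hm0 : (m : ℝ) ≠ 0 := by positivity
  simp only [h1, Finset.sum_add_distrib, Finset.sum_sub_distrib, ← Finset.mul_sum, h0,
    Finset.sum_const, Finset.card_univ, Fintype.card_prod, Fintype.card_fin, nsmul_eq_mul,
    Nat.cast_mul, traceNorm]
  field_simp

theorem IsBlockPositive.traceNorm_le (hW : IsBlockPositive W) (hm : 0 < m) (htr : W.trace = 1) :
    traceNorm W ≤ m := by
  have h1 := sum_sq_sqrt_eigenvalues_sub hW hm
  have h2 := hW.trace_mul_self_le
  rw [htr, mul_one, Complex.one_re] at h2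
  have h3 : 0 ≤ (W * W).trace.re - 2 * (m : ℝ)⁻¹ * traceNorm W + 1 := by
    rw [← h1]
    exact Finset.sum_nonneg fun _ _ => sq_nonneg _
  have hm0 : (0 : ℝ) < m := by positivity
  have h4 : (m : ℝ)⁻¹ * traceNorm W ≤ 1 := by linarith
  rwa [inv_mul_le_iff₀ hm0, mul_one] at h4

theorem IsBlockPositive.mul_self_of_traceNorm_eq (hW : IsBlockPositive W) (hm : 0 < m)
    (htr : W.trace = 1) (h : traceNorm W = m) :
    W * W = (((m : ℝ)⁻¹ ^ 2 : ℝ) : ℂ) • (1 : BipartiteMatrix m m) := by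
  have hm0 : (0 : ℝ) < m := by positivity
  have h1 := sum_sq_sqrt_eigenvalues_sub hW hm
  have h2 := hW.trace_mul_self_le
  rw [htr, mul_one, Complex.one_re] at h2
  rw [h, mul_assoc, inv_mul_cancel₀ hm0.ne'] at h1
  have h3 : ∑ i, (√((isHermitian_conjTranspose_mul_self W).eigenvalues i) - (m : ℝ)⁻¹) ^ 2 = 0 :=
    le_antisymm (by linarith) (Finset.sum_nonneg fun _ _ => sq_nonneg _)
  rw [Finset.sum_eq_zero_iff_of_nonneg fun _ _ => sq_nonneg _] at h3
  have h4 : ∀ i, (isHermitian_conjTranspose_mul_self W).eigenvalues i = (m : ℝ)⁻¹ ^ 2 := by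
    intro i
    have := h3 i (Finset.mem_univ i)
    rw [sq_eq_zero_iff, sub_eq_zero] at this
    rw [← this, Real.sq_sqrt (eigenvalues_conjTranspose_mul_self_nonneg W i)]
  have h5 := (isHermitian_conjTranspose_mul_self W).spectral_theorem
  have h6 : diagonal ((RCLike.ofReal : ℝ → ℂ) ∘
      (isHermitian_conjTranspose_mul_self W).eigenvalues) =
      (((m : ℝ)⁻¹ ^ 2 : ℝ) : ℂ) • (1 : BipartiteMatrix m m) := by
    rw [smul_one_eq_diagonal]
    congr 1
    ext i
    simp only [Function.comp_apply, h4]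
    rfl
  rw [h6, map_smul, map_one, hW.isHermitian.eq] at h5
  exact h5

/-- The two multiplicities have sum m² and, from the sum of the μ k, difference m. -/
theorem card_of_forall_sq_eq {ι : Type*} [Fintype ι] {μ : ι → ℝ} (hm : 0 < m)
    (hc : Fintype.card ι = m * m) (hsum : ∑ k, μ k = 1) (hsq : ∀ k, μ k ^ 2 = (m : ℝ)⁻¹ ^ 2) :
    (Finset.univ.filter fun k => μ k = 1 / (m : ℝ)).card = m * (m + 1) / 2 ∧
      (Finset.univ.filter fun k => μ k = -(1 / (m : ℝ))).card = m * (m - 1) / 2 := by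
  have hm0 : (0 : ℝ) < m := by positivity
  set p := (Finset.univ.filter fun k => μ k = 1 / (m : ℝ)).card with hp
  set q := (Finset.univ.filter fun k => μ k = -(1 / (m : ℝ))).card with hq
  have hor : ∀ k, μ k = 1 / (m : ℝ) ∨ μ k = -(1 / (m : ℝ)) := fun k => by
    rw [one_div]
    exact sq_eq_sq_iff_eq_or_eq_neg.1 (hsq k)
  have hne : (1 / (m : ℝ)) ≠ -(1 / (m : ℝ)) := by
    have : 0 < 1 / (m : ℝ) := by positivity
    linarith
  have hne' : -(1 / (m : ℝ)) ≠ (1 / (m : ℝ)) := hne.symm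
  have h1 : ∀ k, (if μ k = 1 / (m : ℝ) then (1 : ℝ) else 0) +
      (if μ k = -(1 / (m : ℝ)) then (1 : ℝ) else 0) = 1 := fun k => by
    rcases hor k with h | h <;> rw [h] <;> simp only [hne, hne', if_true, if_false] <;> norm_num
  have h2 : ∀ k, (if μ k = 1 / (m : ℝ) then (1 : ℝ) else 0) -
      (if μ k = -(1 / (m : ℝ)) then (1 : ℝ) else 0) = m * μ k := fun k => by
    rcases hor k with h | h <;> rw [h] <;> simp only [hne, hne', if_true, if_false] <;>
      field_simp <;> norm_num
  have h3 : (p : ℝ) + q = m * m := by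
    have := Finset.sum_congr (rfl : (Finset.univ : Finset ι) = Finset.univ) fun k _ => h1 k
    rw [Finset.sum_add_distrib, Finset.sum_boole, Finset.sum_boole] at this
    rw [hp, hq, this]
    simp [hc]
  have h4 : (p : ℝ) - q = m := by
    have := Finset.sum_congr (rfl : (Finset.univ : Finset ι) = Finset.univ) fun k _ => h2 k
    rw [Finset.sum_sub_distrib, Finset.sum_boole, Finset.sum_boole, ← Finset.mul_sum, hsum] at this
    rw [hp, hq, this, mul_one]
  have h5 : p * 2 = m * (m + 1) := by
    have : (p : ℝ) * 2 = m * (m + 1) := by linarith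
    exact_mod_cast this
  have h6 : q * 2 = m * (m - 1) := by
    have : (q : ℝ) * 2 = m * ((m - 1 : ℕ) : ℝ) := by
      rw [Nat.cast_sub hm]
      push_cast
      linarith
    exact_mod_cast this
  constructor <;> omega

end Negativity

theorem sum_norm_sq_dotProduct_le {ι κ : Type*} [Fintype ι] [Fintype κ] [DecidableEq κ]
    {w : κ → ι → ℂ} (hw : ∀ k l, star (w k) ⬝ᵥ w l = if k = l then 1 else 0) (x : ι → ℂ) :
    ∑ k, ‖star (w k) ⬝ᵥ x‖ ^ 2 ≤ (star x ⬝ᵥ x).re := by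
  have hin : ∀ x y : EuclideanSpace ℂ ι, inner ℂ x y = star x.ofLp ⬝ᵥ y.ofLp := by
    intro x y
    rw [EuclideanSpace.inner_eq_star_dotProduct, dotProduct_comm]
  have ho : Orthonormal ℂ fun k => WithLp.toLp 2 (w k) := by
    rw [orthonormal_iff_ite]
    intro k l
    rw [hin, hw]
  have h := ho.sum_inner_products_le (s := Finset.univ) (WithLp.toLp 2 x)
  simp only [hin] at h
  rwa [← inner_self_eq_norm_sq (𝕜 := ℂ), hin] at h

theorem star_dotProduct_self_re_nonneg {ι : Type*} [Fintype ι] (x : ι → ℂ) :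
    0 ≤ (star x ⬝ᵥ x).re := (Complex.le_def.1 (dotProduct_star_self_nonneg x)).1

theorem star_dotProduct_self_eq {ι : Type*} [Fintype ι] (x : ι → ℂ) :
    star x ⬝ᵥ x = ((star x ⬝ᵥ x).re : ℂ) := by
  refine (Complex.conj_eq_iff_re.1 ?_).symm
  change star _ = _
  rw [← star_dotProduct]

theorem star_dotProduct_smul_self {ι : Type*} [Fintype ι] (c : ℂ) (x : ι → ℂ) :
    (star (c • x) ⬝ᵥ (c • x)).re = ‖c‖ ^ 2 * (star x ⬝ᵥ x).re := by
  rw [star_smul, smul_dotProduct, dotProduct_smul, smul_eq_mul, smul_eq_mul, ← mul_assoc]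
  have : star c * c = ((‖c‖ ^ 2 : ℝ) : ℂ) := by
    rw [← Complex.normSq_eq_norm_sq, Complex.normSq_eq_conj_mul_self]
    rfl
  rw [this, Complex.re_ofReal_mul]

/-! ### Completing a two-qubit vector to a product vector -/

section TwoQubits

/-- The symmetric bilinear form whose quadratic form is twice the determinant. -/
def detForm (x y : Fin 2 × Fin 2 → ℂ) : ℂ :=
  x (0, 0) * y (1, 1) + x (1, 1) * y (0, 0) - x (0, 1) * y (1, 0) - x (1, 0) * y (0, 1)

/-- The spin flip on two qubits. -/
noncomputable def spinFlip (x : Fin 2 × Fin 2 → ℂ) : Fin 2 × Fin 2 → ℂ :=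
  fun p => (-1) ^ (p.1 + p.2 : ℕ) * star (x (1 - p.1, 1 - p.2))

theorem star_spinFlip_dotProduct (x y : Fin 2 × Fin 2 → ℂ) :
    star (spinFlip x) ⬝ᵥ y = detForm x y := by
  simp [dotProduct, Fintype.sum_prod_type, spinFlip, detForm]
  ring

theorem spinFlip_dotProduct_self (x : Fin 2 × Fin 2 → ℂ) :
    star (spinFlip x) ⬝ᵥ spinFlip x = star x ⬝ᵥ x := by
  simp [dotProduct, Fintype.sum_prod_type, spinFlip]
  ring

theorem detForm_comm (x y : Fin 2 × Fin 2 → ℂ) : detForm x y = detForm y x := by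
  simp only [detForm]
  ring

theorem exists_orthogonal_three (a b c : Fin 2 × Fin 2 → ℂ) :
    ∃ x : Fin 2 × Fin 2 → ℂ, star x ⬝ᵥ x = 1 ∧ star a ⬝ᵥ x = 0 ∧ star b ⬝ᵥ x = 0 ∧
      star c ⬝ᵥ x = 0 := by
  set A : Matrix (Fin 3) (Fin 2 × Fin 2) ℂ := of ![star a, star b, star c] with hA
  have h1 : LinearMap.ker A.mulVecLin ≠ ⊥ := LinearMap.ker_ne_bot_of_finrank_lt (by simp)
  obtain ⟨x, hx, hx0⟩ := Submodule.exists_mem_ne_zero_of_ne_bot h1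
  rw [LinearMap.mem_ker, mulVecLin_apply] at hx
  have hpos : 0 < (star x ⬝ᵥ x).re := by
    refine lt_of_le_of_ne (star_dotProduct_self_re_nonneg x) fun h => hx0 ?_
    rw [← dotProduct_star_self_eq_zero, star_dotProduct_self_eq, ← h]
    simp
  set t := (star x ⬝ᵥ x).re with ht
  have h2 : ∀ j, A j ⬝ᵥ x = 0 := fun j => congrFun hx j
  have h3 : ∀ j, A j ⬝ᵥ (((√t)⁻¹ : ℝ) : ℂ) • x = 0 := fun j => by
    rw [dotProduct_smul, h2, smul_zero]
  refine ⟨(((√t)⁻¹ : ℝ) : ℂ) • x, ?_, h3 0, h3 1, h3 2⟩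
  rw [star_dotProduct_self_eq, star_dotProduct_smul_self, ← ht, Complex.norm_real, norm_inv,
    inv_pow, Real.norm_eq_abs, sq_abs, Real.sq_sqrt hpos.le, inv_mul_cancel₀ hpos.ne',
    Complex.ofReal_one]

/-- A quadratic polynomial whose leading coefficient dominates has a small root. -/
theorem exists_small_root {a b c : ℂ} {t : ℝ} (ht : 0 < t) (h : ‖c‖ * t ≤ ‖a‖) :
    ∃ τ : ℂ, ‖τ‖ ^ 2 * t ≤ 1 ∧ c + 2 * τ * b + τ ^ 2 * a = 0 := by
  by_cases ha : a = 0
  · refine ⟨0, by simp, ?_⟩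
    rw [ha, norm_zero] at h
    have : ‖c‖ = 0 := le_antisymm (nonpos_of_mul_nonpos_left h ht) (norm_nonneg c)
    simp [norm_eq_zero.1 this]
  · obtain ⟨δ, hδ⟩ := IsAlgClosed.exists_pow_nat_eq (b ^ 2 - a * c) (n := 2) (by norm_num)
    have key : ∀ ε : ℂ, ε ^ 2 = δ ^ 2 →
        c + 2 * ((-b + ε) / a) * b + ((-b + ε) / a) ^ 2 * a = 0 := by
      intro ε hε
      rw [hδ] at hε
      field_simp
      linear_combination hε
    -- The two roots have product c / a, so the smaller one satisfies ‖τ‖² ≤ ‖c‖ / ‖a‖.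
    have hprod : ((-b + δ) / a) * ((-b + -δ) / a) = c / a := by
      field_simp
      linear_combination -hδ
    have hn : ‖(-b + δ) / a‖ * ‖(-b + -δ) / a‖ * t ≤ 1 := by
      rw [← norm_mul, hprod, norm_div, div_mul_eq_mul_div, div_le_one (norm_pos_iff.2 ha)]
      exact h
    rcases le_total ‖(-b + δ) / a‖ ‖(-b + -δ) / a‖ with hle | hle
    · refine ⟨_, le_trans ?_ hn, key δ rfl⟩
      rw [sq]
      exact mul_le_mul_of_nonneg_right (mul_le_mul_of_nonneg_left hle (norm_nonneg _)) ht.le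
    · refine ⟨_, le_trans ?_ hn, key (-δ) (neg_sq δ)⟩
      rw [sq]
      exact mul_le_mul_of_nonneg_right (mul_le_mul_of_nonneg_right hle (norm_nonneg _)) ht.le

/-- Choose χ orthogonal to φ, ψ and the spin flip of φ. The flip of χ, stripped of its ψ component,
is again orthogonal to φ and ψ; with ξ its normalization, one of χ ± ξ works by polarization. -/
theorem exists_orthogonal_large_det {φ ψ : Fin 2 × Fin 2 → ℂ} (hφψ : star φ ⬝ᵥ ψ = 0)
    (hψ : star ψ ⬝ᵥ ψ = 1) :
    ∃ x : Fin 2 × Fin 2 → ℂ, 0 < (star x ⬝ᵥ x).re ∧ star φ ⬝ᵥ x = 0 ∧ star ψ ⬝ᵥ x = 0 ∧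
      ‖detForm ψ ψ‖ * (star x ⬝ᵥ x).re ≤ ‖detForm x x‖ := by
  obtain ⟨χ, hχ, hχφ, hχψ, hχf⟩ := exists_orthogonal_three φ ψ (spinFlip φ)
  rw [star_spinFlip_dotProduct] at hχf
  set c : ℂ := star ψ ⬝ᵥ spinFlip χ with hc
  have hcd : detForm χ ψ = star c := by
    rw [← star_spinFlip_dotProduct, star_dotProduct]
  -- Bessel's inequality for the flip of ψ against the pair ψ, χ; it yields κ ≤ e below.
  have hc1 : ‖detForm ψ ψ‖ ^ 2 + ‖c‖ ^ 2 ≤ 1 := by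
    have ho : ∀ k l : Fin 2, star ((![ψ, χ] : Fin 2 → _) k) ⬝ᵥ (![ψ, χ] : Fin 2 → _) l =
        if k = l then (1 : ℂ) else 0 := by
      have : star χ ⬝ᵥ ψ = 0 := by rw [star_dotProduct, hχψ, star_zero]
      intro k l
      fin_cases k <;> fin_cases l <;> simp [hψ, hχ, hχψ, this]
    have h := sum_norm_sq_dotProduct_le ho (spinFlip ψ)
    rw [Fin.sum_univ_two, spinFlip_dotProduct_self, hψ] at h
    simp only [cons_val_zero, cons_val_one, Complex.one_re] at h
    rw [star_dotProduct ψ, star_dotProduct χ, star_spinFlip_dotProduct, star_spinFlip_dotProduct,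
      detForm_comm ψ χ, hcd, star_star, norm_star] at h
    exact h
  set η : Fin 2 × Fin 2 → ℂ := spinFlip χ - c • ψ with hη
  have hηφ : star φ ⬝ᵥ η = 0 := by
    rw [hη, dotProduct_sub, dotProduct_smul, hφψ, smul_zero, sub_zero, star_dotProduct,
      star_spinFlip_dotProduct, detForm_comm, hχf, star_zero]
  have hηψ : star ψ ⬝ᵥ η = 0 := by
    rw [hη, dotProduct_sub, dotProduct_smul, hψ, ← hc, smul_eq_mul, mul_one, sub_self]
  have hcc : c * star c = ((‖c‖ ^ 2 : ℝ) : ℂ) := by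
    rw [← Complex.normSq_eq_norm_sq, ← Complex.mul_conj]
    rfl
  have hdη : detForm χ η = ((1 - ‖c‖ ^ 2 : ℝ) : ℂ) := by
    rw [← star_spinFlip_dotProduct, hη, dotProduct_sub, dotProduct_smul, spinFlip_dotProduct_self,
      hχ, star_spinFlip_dotProduct, hcd, smul_eq_mul, hcc]
    push_cast
    ring
  have hηη : star η ⬝ᵥ η = ((1 - ‖c‖ ^ 2 : ℝ) : ℂ) := by
    nth_rewrite 1 [hη]
    rw [star_sub, star_smul, sub_dotProduct, smul_dotProduct, hηψ, smul_zero, sub_zero,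
      star_spinFlip_dotProduct, hdη]
  set κ := ‖detForm ψ ψ‖ with hκ
  set e := √(1 - ‖c‖ ^ 2) with he
  have hκe : κ ≤ e := Real.le_sqrt_of_sq_le (by linarith)
  have hee : e ^ 2 = 1 - ‖c‖ ^ 2 := Real.sq_sqrt (by nlinarith [sq_nonneg κ])
  -- If the stripped flip vanishes, then κ = 0 and χ itself serves.
  rcases (Real.sqrt_nonneg _ : 0 ≤ e).eq_or_lt with he0 | he0
  · refine ⟨χ, by rw [hχ]; norm_num, hχφ, hχψ, ?_⟩
    have : κ = 0 := le_antisymm (by rw [he0]; exact hκe) (norm_nonneg _)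
    rw [this, zero_mul]
    exact norm_nonneg _
  · set ξ : Fin 2 × Fin 2 → ℂ := ((e⁻¹ : ℝ) : ℂ) • η with hξ
    have hξφ : star φ ⬝ᵥ ξ = 0 := by rw [hξ, dotProduct_smul, hηφ, smul_zero]
    have hξψ : star ψ ⬝ᵥ ξ = 0 := by rw [hξ, dotProduct_smul, hηψ, smul_zero]
    have hξξ : (star ξ ⬝ᵥ ξ).re = 1 := by
      rw [hξ, star_dotProduct_smul_self, hηη, Complex.ofReal_re, ← hee, Complex.norm_real, norm_inv,
        Real.norm_eq_abs, abs_of_pos he0, inv_pow, inv_mul_cancel₀ (pow_ne_zero 2 he0.ne')]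
    have hdξ : detForm χ ξ = (e : ℂ) := by
      rw [hξ, ← star_spinFlip_dotProduct, dotProduct_smul, star_spinFlip_dotProduct, hdη, ← hee,
        smul_eq_mul, ← Complex.ofReal_mul]
      congr 1
      field_simp
    have hsum : (star (χ + ξ) ⬝ᵥ (χ + ξ)).re + (star (χ - ξ) ⬝ᵥ (χ - ξ)).re = 4 := by
      have : star (χ + ξ) ⬝ᵥ (χ + ξ) + star (χ - ξ) ⬝ᵥ (χ - ξ) =
          2 * (star χ ⬝ᵥ χ) + 2 * (star ξ ⬝ᵥ ξ) := by
        simp only [star_add, star_sub, add_dotProduct, sub_dotProduct, dotProduct_add,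
          dotProduct_sub]
        ring
      rw [← Complex.add_re, this, hχ, star_dotProduct_self_eq ξ, hξξ]
      norm_num
    have hdet : 4 * e ≤ ‖detForm (χ + ξ) (χ + ξ)‖ + ‖detForm (χ - ξ) (χ - ξ)‖ := by
      have : detForm (χ + ξ) (χ + ξ) - detForm (χ - ξ) (χ - ξ) = ((4 * e : ℝ) : ℂ) := by
        push_cast
        rw [← hdξ]
        simp only [detForm, Pi.add_apply, Pi.sub_apply]
        ring
      calc 4 * e = ‖((4 * e : ℝ) : ℂ)‖ := by
            rw [Complex.norm_real, Real.norm_eq_abs, abs_of_pos (by positivity)]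
        _ ≤ _ := by
            rw [← this]
            exact norm_sub_le _ _
    -- The squared lengths of χ ± ξ sum to 4 and the form values to at least 4e ≥ 4κ, so the ratios
    -- cannot both be below κ. A zero vector among the two is treated apart.
    by_contra! hcon
    have h1 := hcon (χ + ξ)
    have h2 := hcon (χ - ξ)
    rw [dotProduct_add (star φ), dotProduct_add (star ψ), hχφ, hχψ, hξφ, hξψ, add_zero] at h1
    rw [dotProduct_sub (star φ), dotProduct_sub (star ψ), hχφ, hχψ, hξφ, hξψ, sub_zero] at h2
    have n1 := star_dotProduct_self_re_nonneg (χ + ξ)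
    have n2 := star_dotProduct_self_re_nonneg (χ - ξ)
    have z1 : (star (χ + ξ) ⬝ᵥ (χ + ξ)).re = 0 → ‖detForm (χ + ξ) (χ + ξ)‖ = 0 := fun h => by
      have : χ + ξ = 0 := by
        rw [← dotProduct_star_self_eq_zero, star_dotProduct_self_eq, h,
          Complex.ofReal_zero]
      rw [this]
      simp [detForm]
    have z2 : (star (χ - ξ) ⬝ᵥ (χ - ξ)).re = 0 → ‖detForm (χ - ξ) (χ - ξ)‖ = 0 := fun h => by
      have : χ - ξ = 0 := by
        rw [← dotProduct_star_self_eq_zero, star_dotProduct_self_eq, h,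
          Complex.ofReal_zero]
      rw [this]
      simp [detForm]
    set s1 := (star (χ + ξ) ⬝ᵥ (χ + ξ)).re
    set s2 := (star (χ - ξ) ⬝ᵥ (χ - ξ)).re
    rcases n1.eq_or_lt with e1 | e1
    · have hs2 : s2 = 4 := by linarith
      have h3 := h2 (by rw [hs2]; norm_num) rfl rfl
      have h4 := z1 e1.symm
      rw [hs2] at h3
      linarith
    · have h3 := h1 e1 rfl rfl
      rcases n2.eq_or_lt with e2 | e2
      · have hs1 : s1 = 4 := by linarith
        have h4 := z2 e2.symm
        rw [hs1] at h3
        linarith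
      · have h4 := h2 e2 rfl rfl
        have h5 : κ * s1 + κ * s2 ≤ 4 * e := by
          rw [← mul_add, hsum]
          linarith
        linarith

/-- Every vector orthogonal to `φ` becomes a product vector after adding a vector that is not
longer and orthogonal to both. -/
theorem exists_orthogonal_det_eq_zero {φ ψ : Fin 2 × Fin 2 → ℂ} (hφψ : star φ ⬝ᵥ ψ = 0)
    (hψ : star ψ ⬝ᵥ ψ = 1) :
    ∃ η : Fin 2 × Fin 2 → ℂ, star φ ⬝ᵥ η = 0 ∧ star ψ ⬝ᵥ η = 0 ∧ (star η ⬝ᵥ η).re ≤ 1 ∧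
      detForm (ψ + η) (ψ + η) = 0 := by
  obtain ⟨x, hx0, hxφ, hxψ, hx⟩ := exists_orthogonal_large_det hφψ hψ
  obtain ⟨τ, hτ, hroot⟩ := exists_small_root (b := detForm ψ x) hx0 hx
  refine ⟨τ • x, by rw [dotProduct_smul, hxφ, smul_zero], by rw [dotProduct_smul, hxψ, smul_zero],
    ?_, ?_⟩
  · rw [star_dotProduct_smul_self]
    exact hτ
  · rw [← hroot]
    simp only [detForm, Pi.add_apply, Pi.smul_apply, smul_eq_mul]
    ring

theorem exists_productVector_of_detForm_eq_zero {v : Fin 2 × Fin 2 → ℂ} (h : detForm v v = 0) :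
    ∃ a b, v = productVector a b := by
  have h' : v (0, 0) * v (1, 1) = v (0, 1) * v (1, 0) := by
    simp only [detForm] at h
    linear_combination h / 2
  by_cases h0 : v (0, 0) = 0 ∧ v (0, 1) = 0
  · refine ⟨![0, 1], ![v (1, 0), v (1, 1)], ?_⟩
    ext ⟨i, j⟩
    fin_cases i <;> fin_cases j <;> simp [productVector, h0.1, h0.2]
  · by_cases h1 : v (0, 0) = 0
    · have h2 : v (0, 1) ≠ 0 := fun h2 => h0 ⟨h1, h2⟩
      refine ⟨![1, v (1, 1) / v (0, 1)], ![v (0, 0), v (0, 1)], ?_⟩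
      ext ⟨i, j⟩
      have : v (1, 0) = 0 := by
        rw [h1, zero_mul] at h'
        exact (mul_eq_zero.1 h'.symm).resolve_left h2
      fin_cases i <;> fin_cases j <;> simp [productVector, h1, h2, this]
    · refine ⟨![1, v (1, 0) / v (0, 0)], ![v (0, 0), v (0, 1)], ?_⟩
      ext ⟨i, j⟩
      fin_cases i <;> fin_cases j <;> simp [productVector, h1]
      field_simp
      linear_combination h'

end TwoQubits

/-- For a block-positive `2 × n` matrix, the least eigenvalue is at least minus the second
largest one. -/
theorem IsBlockPositive.add_nonneg_of_sortedEigenbasis {n : ℕ} {W : BipartiteMatrix 2 n}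
    (hW : IsBlockPositive W) {μ : Fin (2 * n) → ℝ} {w : Fin (2 * n) → Fin 2 × Fin n → ℂ}
    (h : SortedEigenbasis W μ w) {i₀ i₁ l : Fin (2 * n)} (h0 : (i₀ : ℕ) = 0) (h1 : (i₁ : ℕ) = 1)
    (hl : i₀ ≠ l) (hneg : μ l < 0) : 0 ≤ μ i₁ + μ l := by
  obtain ⟨Y, E, s, hY, hs, hE, hE', hM⟩ :=
    exists_singular_value_decomposition (of fun i k => w l (i, k))
  have hψ : (Y ⊗ₖ E) *ᵥ schmidtVector s = w l := by
    ext ⟨i, k⟩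
    rw [kronecker_mulVec_schmidtVector, ← hM, of_apply]
  have hprod : ∀ a b, w l ≠ productVector a b := fun a b hab => by
    have h2 := hW.nonneg a b
    rw [← hab, h.quadraticForm_self, Complex.ofReal_re] at h2
    exact hneg.not_ge h2
  -- A vanishing Schmidt coefficient would make the eigenvector a product vector, where W is
  -- nonnegative. Hence E is an isometry and the problem moves to two qubits.
  have hs0 : ∀ j, s j ≠ 0 := by
    intro j hj
    refine hprod (fun i => (s (1 - j) : ℂ) * Y i (1 - j)) (fun k => E k (1 - j)) ?_
    ext ⟨i, k⟩
    have := hM i k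
    rw [of_apply, Fin.sum_univ_two] at this
    rw [this, productVector]
    fin_cases j <;> simp at hj <;> simp [hj] <;> ring
  have hEE : Eᴴ * E = 1 := by
    rw [hE]
    simp [hs0]
  have hYY : Yᴴ * Y = 1 := mul_eq_one_comm.1 hY
  have hK : ∀ x y : Fin 2 × Fin 2 → ℂ, star ((Y ⊗ₖ E) *ᵥ x) ⬝ᵥ ((Y ⊗ₖ E) *ᵥ y) = star x ⬝ᵥ y := by
    intro x y
    have h2 := dotProduct_conj_mulVec 1 (Y ⊗ₖ E) x y
    rw [one_mulVec, Matrix.mul_one, conjTranspose_kronecker, ← mul_kronecker_mul, hYY, hEE,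
      one_kronecker_one, one_mulVec] at h2
    exact h2.symm
  have hK' : ∀ y : Fin 2 × Fin 2 → ℂ, star ((Y ⊗ₖ E)ᴴ *ᵥ w i₀) ⬝ᵥ y =
      star (w i₀) ⬝ᵥ ((Y ⊗ₖ E) *ᵥ y) := by
    intro y
    rw [star_mulVec, conjTranspose_conjTranspose, ← Matrix.dotProduct_mulVec]
  obtain ⟨η, hη1, hη2, hη3, hη4⟩ := exists_orthogonal_det_eq_zero
    (φ := (Y ⊗ₖ E)ᴴ *ᵥ w i₀) (ψ := schmidtVector s)
    (by rw [hK', hψ, h.orthonormal, if_neg hl]) (by rw [← hK, hψ, h.orthonormal, if_pos rfl])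
  obtain ⟨a, b, hab⟩ := exists_productVector_of_detForm_eq_zero hη4
  set x := (Y ⊗ₖ E) *ᵥ η with hx
  have hx0 : star (w i₀) ⬝ᵥ x = 0 := by rw [hx, ← hK', hη1]
  have hxl : star (w l) ⬝ᵥ x = 0 := by rw [← hψ, hx, hK, hη2]
  have hxx : (star x ⬝ᵥ x).re ≤ 1 := by rw [hx, hK]; exact hη3
  have hxn := star_dotProduct_self_re_nonneg x
  have hpos := hW.nonneg (Y *ᵥ a) (E *ᵥ b)
  rw [← kronecker_mulVec_productVector, ← hab, mulVec_add, hψ, ← hx,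
    h.quadraticForm hW.isHermitian] at hpos
  -- The vector x has no component along the top eigenvector, so all its weight sits on eigenvalues
  -- at most μ i₁.
  have hle : ∑ k, μ k * ‖star (w k) ⬝ᵥ (w l + x)‖ ^ 2 ≤
      ∑ k, ((if k = l then μ l else 0) + μ i₁ * ‖star (w k) ⬝ᵥ x‖ ^ 2) := by
    refine Finset.sum_le_sum fun k _ => ?_
    rw [dotProduct_add, h.orthonormal]
    by_cases hkl : k = l
    · subst hkl
      rw [hxl]
      simp
    · rw [if_neg hkl, if_neg hkl, zero_add, zero_add]
      by_cases hk0 : k = i₀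
      · rw [hk0, hx0]
        simp
      · have : i₁ ≤ k := by
          rw [Fin.le_def, h1]
          have : (k : ℕ) ≠ 0 := fun hk => hk0 (Fin.ext (hk.trans h0.symm))
          omega
        exact mul_le_mul_of_nonneg_right (h.antitone this) (by positivity)
  rw [Finset.sum_add_distrib, Finset.sum_ite_eq', if_pos (Finset.mem_univ l), ← Finset.mul_sum,
    ← h.self_dotProduct] at hle
  by_contra! hcon
  rcases le_total (μ i₁) 0 with hμ | hμ
  · have := mul_nonpos_of_nonpos_of_nonneg hμ hxn
    linarith
  · have := mul_le_of_le_one_right hμ hxx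
    linarith

/-- Unitary matrices are unitarily diagonalizable, by the Cayley transform. -/
theorem exists_unitary_diagonalization {ι : Type*} [Fintype ι] [DecidableEq ι] {U : Matrix ι ι ℂ}
    (hU : Uᴴ * U = 1) : ∃ (V : Matrix ι ι ℂ) (ω : ι → ℂ), V * Vᴴ = 1 ∧ (∀ i, ‖ω i‖ = 1) ∧
      U = V * diagonal ω * Vᴴ := by
  have hUU : U * Uᴴ = 1 := mul_eq_one_comm.1 hU
  -- The unit circle is infinite and the spectrum finite.
  obtain ⟨c, hc1, hc⟩ : ∃ c : ℂ, ‖c‖ = 1 ∧ c ∉ spectrum ℂ U := by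
    have hinf : (Metric.sphere (0 : ℂ) 1).Infinite :=
      (isPreconnected_sphere (by rw [Complex.rank_real_complex]; norm_num) 0 1).infinite_of_nontrivial
        ⟨1, by simp, -1, by simp, by norm_num⟩
    obtain ⟨c, hc, hc'⟩ := hinf.exists_notMem_finite U.finite_spectrum
    exact ⟨c, by simpa using hc, hc'⟩
  have hcc : star c * c = 1 := by
    change starRingEnd ℂ c * c = 1
    rw [← Complex.normSq_eq_conj_mul_self, Complex.normSq_eq_norm_sq, hc1]
    norm_num
  set B : Matrix ι ι ℂ := c • 1 - U with hB
  set C : Matrix ι ι ℂ := c • 1 + U with hC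
  have hBu : IsUnit B := by
    have := spectrum.notMem_iff.1 hc
    rwa [Algebra.algebraMap_eq_smul_one] at this
  obtain ⟨B', hBB', hB'B⟩ : ∃ B', B * B' = 1 ∧ B' * B = 1 := by
    obtain ⟨u, hu⟩ := hBu
    exact ⟨↑u⁻¹, by rw [← hu]; simp, by rw [← hu]; simp⟩
  have hBC : Bᴴ * C = star c • U - c • Uᴴ := by
    rw [hB, hC, conjTranspose_sub, conjTranspose_smul, conjTranspose_one, sub_mul, mul_add,
      mul_add, hU, smul_mul_smul_comm, hcc]
    simp only [smul_mul_assoc, mul_smul_comm, Matrix.one_mul, Matrix.mul_one, one_smul]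
    abel
  have hM : (Complex.I • (Bᴴ * C)).IsHermitian := by
    rw [IsHermitian, hBC, conjTranspose_smul, conjTranspose_sub, conjTranspose_smul,
      conjTranspose_smul, conjTranspose_conjTranspose, star_star]
    change starRingEnd ℂ Complex.I • _ = _
    rw [Complex.conj_I]
    module
  have hA := isHermitian_conjTranspose_mul_mul B' hM
  -- This is the Cayley transform i(c + U)(c - U)⁻¹, written as a congruence so that it is visibly
  -- Hermitian.
  set A := B'ᴴ * (Complex.I • (Bᴴ * C)) * B' with hAdef
  have hBA : B * A = Complex.I • C := by
    have h1 : B'ᴴ * Bᴴ = 1 := by rw [← conjTranspose_mul, hBB', conjTranspose_one]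
    have h2 : A = Complex.I • (C * B') := by
      rw [hAdef, mul_smul_comm, smul_mul_assoc, ← Matrix.mul_assoc, h1, Matrix.one_mul]
    have h3 : B * C = C * B := by
      rw [hB, hC, sub_mul, mul_add, mul_add, add_mul, mul_sub, mul_sub]
      simp only [smul_mul_assoc, mul_smul_comm, Matrix.one_mul, Matrix.mul_one]
      abel
    rw [h2, mul_smul_comm, ← Matrix.mul_assoc, h3, Matrix.mul_assoc, hBB', Matrix.mul_one]
  have hne : ∀ i, (Complex.I + hA.eigenvalues i : ℂ) ≠ 0 := fun i h => by
    have := congrArg Complex.im h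
    simp at this
  set V : Matrix ι ι ℂ := (hA.eigenvectorUnitary : Matrix ι ι ℂ) with hV
  have hVV : V * Vᴴ = 1 := Unitary.coe_mul_star_self hA.eigenvectorUnitary
  -- The solution u of i(c + u) = a(c - u), with a an eigenvalue of A.
  set ω : ι → ℂ := fun i => c * (hA.eigenvalues i - Complex.I) / (Complex.I + hA.eigenvalues i)
  have hUV : U * V = V * diagonal ω := by
    ext p i
    have h1 := hA.mulVec_eigenvectorBasis i
    have h2 := congrArg (fun x => B *ᵥ x) h1
    simp only [mulVec_mulVec, hBA] at h2
    have h3 := congrFun h2 p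
    rw [hC, hB, smul_mulVec, add_mulVec, sub_mulVec, smul_mulVec, one_mulVec] at h3
    rw [mulVec_smul] at h3
    simp only [Pi.smul_apply, Pi.add_apply, Pi.sub_apply, smul_mulVec, one_mulVec, mulVec_smul,
      smul_eq_mul, Complex.real_smul] at h3
    rw [mul_diagonal]
    have h4 : (U * V) p i = (U *ᵥ (hA.eigenvectorBasis i).ofLp) p := rfl
    have h5 : V p i = (hA.eigenvectorBasis i).ofLp p := rfl
    rw [h4, h5, mul_div_assoc', eq_div_iff (hne i)]
    linear_combination h3
  refine ⟨V, ω, hVV, fun i => ?_, ?_⟩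
  · have h1 : (hA.eigenvalues i - Complex.I : ℂ) =
        starRingEnd ℂ (Complex.I + hA.eigenvalues i) := by
      simp
      ring
    simp only [ω]
    rw [norm_div, norm_mul, hc1, one_mul, h1, Complex.norm_conj,
      div_self (norm_ne_zero_iff.2 (hne i))]
  · rw [← hUV, Matrix.mul_assoc, hVV, Matrix.mul_one]

/-! ### Bounds on the off-diagonal block of a 2 × n matrix -/

section QubitBlocks

variable {n : ℕ} {W : BipartiteMatrix 2 n}

/-- The numbers ⟨g|Wᵢⱼ|g⟩ form a positive semidefinite 2 × 2 matrix, the partial form of W with its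
factors exchanged. -/
theorem IsBlockPositive.tensorBlock_bounds (hW : IsBlockPositive W) (g : Fin n → ℂ) :
    0 ≤ (star g ⬝ᵥ tensorBlock W 0 0 *ᵥ g).re ∧ 0 ≤ (star g ⬝ᵥ tensorBlock W 1 1 *ᵥ g).re ∧
      ‖star g ⬝ᵥ tensorBlock W 0 1 *ᵥ g‖ ≤ √((star g ⬝ᵥ tensorBlock W 0 0 *ᵥ g).re) *
        √((star g ⬝ᵥ tensorBlock W 1 1 *ᵥ g).re) := by
  have h := hW.swapFactors.posSemidef_partialForm g
  have he : ∀ i j, partialForm (_root_.swapFactors W) g i j =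
      star g ⬝ᵥ tensorBlock W i j *ᵥ g := by
    intro i j
    simp only [partialForm, Matrix.sum_apply, Matrix.smul_apply, smul_eq_mul, tensorBlock, of_apply,
      _root_.swapFactors, submatrix_apply, Prod.swap_prod_mk, dotProduct, mulVec, Pi.star_apply,
      Finset.mul_sum]
    exact Finset.sum_congr rfl fun k _ => Finset.sum_congr rfl fun l _ => by ring
  have h0 := Complex.le_def.1 (h.diag_nonneg (i := 0))
  have h1 := Complex.le_def.1 (h.diag_nonneg (i := 1))
  have hd := h.det_nonneg
  rw [det_fin_two, ← h.isHermitian.apply 1 0] at hd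
  change 0 ≤ _ - _ * starRingEnd ℂ _ at hd
  rw [Complex.mul_conj, Complex.normSq_eq_norm_sq] at hd
  simp only [he, Complex.zero_re, Complex.zero_im] at h0 h1 hd
  refine ⟨h0.1, h1.1, ?_⟩
  have hd' := (Complex.le_def.1 hd).1
  rw [Complex.sub_re, Complex.ofReal_re, Complex.mul_re, ← h0.2, ← h1.2, Complex.zero_re] at hd'
  rw [← Real.sqrt_mul h0.1]
  exact Real.le_sqrt_of_sq_le (by linarith)

/-- The trace norm bound `|tr (X B)| ≤ √(tr P tr Q)` for the blocks of a block-positive matrix,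
where `B` is a corner of a unitary matrix. -/
theorem IsBlockPositive.norm_trace_mul_submatrix_le (hW : IsBlockPositive W) {ι : Type*}
    [Fintype ι] [DecidableEq ι] {U : Matrix ι ι ℂ} (hU : Uᴴ * U = 1) {f : Fin n → ι}
    (hf : Function.Injective f) :
    ‖(tensorBlock W 0 1 * U.submatrix f f).trace‖ ≤
      √((tensorBlock W 0 0).trace.re) * √((tensorBlock W 1 1).trace.re) := by
  obtain ⟨V, ω, hV, hω, rfl⟩ := exists_unitary_diagonalization hU
  have key : ∀ (T : Matrix (Fin n) (Fin n) ℂ) (d : ι → ℂ),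
      (T * (V * diagonal d * Vᴴ).submatrix f f).trace =
        ∑ i, d i * (star (fun k => V (f k) i) ⬝ᵥ T *ᵥ (fun k => V (f k) i)) := by
    intro T d
    have he : ∀ p q, (V * diagonal d * Vᴴ) p q = ∑ i, V p i * d i * star (V q i) := fun p q => by
      rw [mul_apply]
      simp only [mul_diagonal, conjTranspose_apply]
    simp only [trace, diag_apply, Matrix.mul_apply (M := T), submatrix_apply, he, dotProduct, mulVec,
      Pi.star_apply, Finset.mul_sum]
    rw [Finset.sum_congr rfl fun k _ => Finset.sum_comm, Finset.sum_comm]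
    exact Finset.sum_congr rfl fun i _ => Finset.sum_congr rfl fun k _ =>
      Finset.sum_congr rfl fun l _ => by ring
  have htr : ∀ T : Matrix (Fin n) (Fin n) ℂ, T.trace.re =
      ∑ i, (star (fun k => V (f k) i) ⬝ᵥ T *ᵥ (fun k => V (f k) i)).re := by
    intro T
    -- With all phases one the corner is the identity, so the restricted columns of V resolve the
    -- trace of T.
    have h := key T 1
    rw [show diagonal (1 : ι → ℂ) = 1 from diagonal_one, Matrix.mul_one, hV,
      submatrix_one f hf, Matrix.mul_one] at h
    rw [h, Complex.re_sum]
    simp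
  rw [key, htr, htr]
  refine (norm_sum_le _ _).trans ?_
  refine le_trans (Finset.sum_le_sum fun i _ => ?_) (Real.sum_sqrt_mul_sqrt_le Finset.univ
    (fun i => (hW.tensorBlock_bounds _).1) (fun i => (hW.tensorBlock_bounds _).2.1))
  rw [norm_mul, hω, one_mul]
  exact (hW.tensorBlock_bounds _).2.2

/-- If R projects onto the span of the family, 2R - 1 is unitary and its off-diagonal block is twice
that of R; this is the source of the factor 2. -/
theorem IsBlockPositive.norm_offDiagonal_le (hW : IsBlockPositive W) {κ : Type*} [Fintype κ]
    [DecidableEq κ] {w : κ → Fin 2 × Fin n → ℂ}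
    (hw : ∀ k l, star (w k) ⬝ᵥ w l = if k = l then 1 else 0) :
    2 * ‖∑ r, star (fun k => w r (0, k)) ⬝ᵥ tensorBlock W 0 1 *ᵥ (fun k => w r (1, k))‖ ≤
      √((tensorBlock W 0 0).trace.re) * √((tensorBlock W 1 1).trace.re) := by
  set R : Matrix (Fin 2 × Fin n) (Fin 2 × Fin n) ℂ :=
    ∑ r, vecMulVec (w r) (star (w r)) with hR
  have hRH : Rᴴ = R := by
    rw [hR, conjTranspose_sum]
    exact Finset.sum_congr rfl fun r _ => by rw [conjTranspose_vecMulVec, star_star]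
  have hRR : R * R = R := by
    rw [hR, Finset.sum_mul_sum]
    refine Finset.sum_congr rfl fun r _ => ?_
    rw [Finset.sum_eq_single r (fun l _ hl => ?_) (by simp)]
    · rw [vecMulVec_mul_vecMulVec, hw, if_pos rfl, one_smul]
    · rw [vecMulVec_mul_vecMulVec, hw, if_neg hl.symm, zero_smul]
      ext
      simp [vecMulVec_apply]
  -- Exchanging the row blocks moves the off-diagonal block into the corner where the trace bound
  -- applies.
  set e : Fin 2 × Fin n ≃ Fin 2 × Fin n := (Equiv.swap 0 1).prodCongr (Equiv.refl _) with he
  have hU : (((2 : ℂ) • R - 1).submatrix e id)ᴴ * ((2 : ℂ) • R - 1).submatrix e id = 1 := by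
    rw [conjTranspose_submatrix, submatrix_mul_equiv, conjTranspose_sub, conjTranspose_smul, hRH,
      conjTranspose_one, sub_mul, mul_sub, smul_mul_smul_comm, hRR]
    simp only [smul_mul_assoc, Matrix.one_mul, Matrix.mul_one, submatrix_id_id]
    have : star (2 : ℂ) = 2 := by simp
    rw [this]
    module
  have h := hW.norm_trace_mul_submatrix_le hU (f := fun k => ((0 : Fin 2), k))
    (fun k l hkl => (Prod.ext_iff.1 hkl).2)
  refine le_trans (le_of_eq ?_) h
  rw [← Complex.norm_two, ← norm_mul]
  congr 1
  have hent : ∀ k l : Fin n, (((2 : ℂ) • R - 1).submatrix e id).submatrix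
      (fun k => ((0 : Fin 2), k)) (fun k => ((0 : Fin 2), k)) l k =
      2 * ∑ r, w r (1, l) * star (w r (0, k)) := by
    intro k l
    simp [he, hR, Matrix.sum_apply, vecMulVec_apply, one_apply]
  simp only [trace, diag_apply, mul_apply, hent, dotProduct, mulVec, Pi.star_apply,
    Finset.mul_sum]
  rw [Finset.sum_comm]
  refine Finset.sum_congr rfl fun k _ => ?_
  rw [Finset.sum_comm]
  exact Finset.sum_congr rfl fun k _ => Finset.sum_congr rfl fun l _ => by ring

end QubitBlocks

/-! ### Sums over orthonormal families -/

section PartialSums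

variable {n : ℕ} {W : BipartiteMatrix 2 n}

theorem trace_eq_trace_tensorBlock (W : BipartiteMatrix 2 n) :
    W.trace = (tensorBlock W 0 0).trace + (tensorBlock W 1 1).trace := by
  simp [trace, Fintype.sum_prod_type, tensorBlock]

theorem IsBlockPositive.trace_tensorBlock_bounds (hW : IsBlockPositive W) (htr : W.trace = 1) :
    0 ≤ (tensorBlock W 0 0).trace.re ∧ 0 ≤ (tensorBlock W 1 1).trace.re ∧
      (tensorBlock W 0 0).trace.re + (tensorBlock W 1 1).trace.re = 1 ∧
      √((tensorBlock W 0 0).trace.re) * √((tensorBlock W 1 1).trace.re) ≤ 1 / 2 := by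
  have h0 : ∀ i, 0 ≤ (tensorBlock W i i).trace.re := fun i => by
    rw [trace, Complex.re_sum]
    exact Finset.sum_nonneg fun k _ => hW.diag_nonneg (i, k)
  have h1 := congrArg Complex.re (trace_eq_trace_tensorBlock W)
  rw [htr, Complex.one_re, Complex.add_re] at h1
  refine ⟨h0 0, h0 1, h1.symm, ?_⟩
  have a := Real.sq_sqrt (h0 0)
  have b := Real.sq_sqrt (h0 1)
  nlinarith [sq_nonneg (√((tensorBlock W 0 0).trace.re) - √((tensorBlock W 1 1).trace.re))]

theorem quadraticForm_split (hW : W.IsHermitian) (w : Fin 2 × Fin n → ℂ) :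
    (star w ⬝ᵥ W *ᵥ w).re =
      (star (fun k => w (0, k)) ⬝ᵥ tensorBlock W 0 0 *ᵥ (fun k => w (0, k))).re +
      (star (fun k => w (1, k)) ⬝ᵥ tensorBlock W 1 1 *ᵥ (fun k => w (1, k))).re +
      2 * (star (fun k => w (0, k)) ⬝ᵥ tensorBlock W 0 1 *ᵥ (fun k => w (1, k))).re := by
  have h1 : star (fun k => w (1, k)) ⬝ᵥ tensorBlock W 1 0 *ᵥ (fun k => w (0, k)) =
      star (star (fun k => w (0, k)) ⬝ᵥ tensorBlock W 0 1 *ᵥ (fun k => w (1, k))) := by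
    rw [← star_dotProduct, star_mulVec, tensorBlock_conjTranspose hW, Matrix.dotProduct_mulVec]
  have h2 : star w ⬝ᵥ W *ᵥ w = ∑ i, ∑ j,
      star (fun k => w (i, k)) ⬝ᵥ tensorBlock W i j *ᵥ (fun k => w (j, k)) := by
    simp only [dotProduct, mulVec, Fintype.sum_prod_type, Pi.star_apply, tensorBlock, of_apply,
      Finset.mul_sum]
    exact Finset.sum_congr rfl fun i _ => Finset.sum_comm
  rw [h2]
  simp only [Fin.sum_univ_two, h1, Complex.add_re]
  change _ + _ + ((starRingEnd ℂ _).re + _) = _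
  rw [Complex.conj_re]
  ring

/-- The sum of `⟨w, W w⟩` over an orthonormal family is at least `-1/2`. -/
theorem IsBlockPositive.neg_half_le_sum (hW : IsBlockPositive W) (htr : W.trace = 1)
    {κ : Type*} [Fintype κ] [DecidableEq κ] {w : κ → Fin 2 × Fin n → ℂ}
    (hw : ∀ k l, star (w k) ⬝ᵥ w l = if k = l then 1 else 0) :
    -(1 / 2) ≤ ∑ r, (star (w r) ⬝ᵥ W *ᵥ w r).re := by
  obtain ⟨-, -, -, h1⟩ := hW.trace_tensorBlock_bounds htr
  have h2 := hW.norm_offDiagonal_le hw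
  have h3 := Complex.abs_re_le_norm (∑ r, star (fun k => w r (0, k)) ⬝ᵥ
    tensorBlock W 0 1 *ᵥ (fun k => w r (1, k)))
  have h4 := (abs_le.1 h3).1
  rw [Complex.re_sum] at h4
  -- The diagonal blocks contribute nonnegatively and are dropped.
  have h5 : ∑ r, 2 * (star (fun k => w r (0, k)) ⬝ᵥ tensorBlock W 0 1 *ᵥ
      (fun k => w r (1, k))).re ≤ ∑ r, (star (w r) ⬝ᵥ W *ᵥ w r).re := by
    refine Finset.sum_le_sum fun r _ => ?_
    rw [quadraticForm_split hW.isHermitian]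
    have a := (hW.tensorBlock_bounds fun k => w r (0, k)).1
    have b := (hW.tensorBlock_bounds fun k => w r (1, k)).2.1
    linarith
  rw [← Finset.mul_sum] at h5
  linarith

/-- This expresses AAᴴ ≤ g. The nonnegative traces of (g - AAᴴ)P(g - AAᴴ) and AᴴPA(g - AᴴA) add up
to g times the gap. -/
theorem Matrix.PosSemidef.trace_conj_le {ι κ : Type*} [Fintype ι] [DecidableEq ι] [Fintype κ]
    [DecidableEq κ] {P : Matrix ι ι ℂ} (hP : P.PosSemidef) {A : Matrix ι κ ℂ} {d : κ → ℝ}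
    (hA : Aᴴ * A = diagonal fun r => (d r : ℂ)) {g : ℝ} (hg : 0 < g) (hd : ∀ r, d r ≤ g) :
    (Aᴴ * P * A).trace.re ≤ g * P.trace.re := by
  have h1 := (Complex.le_def.1
    (hP.conjTranspose_mul_mul_same ((g : ℂ) • 1 - A * Aᴴ)).trace_nonneg).1
  have h2 : 0 ≤ ((Aᴴ * P * A) * diagonal fun r => ((g - d r : ℝ) : ℂ)).trace.re := by
    rw [trace, Complex.re_sum]
    refine Finset.sum_nonneg fun r _ => ?_
    rw [diag_apply, mul_diagonal, mul_comm, Complex.re_ofReal_mul]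
    exact mul_nonneg (sub_nonneg.2 (hd r))
      (Complex.le_def.1 (hP.conjTranspose_mul_mul_same A).diag_nonneg).1
  have h3 : (diagonal fun r => ((g - d r : ℝ) : ℂ)) = (g : ℂ) • 1 - Aᴴ * A := by
    rw [hA, smul_one_eq_diagonal, diagonal_sub]
    simp
  have h4 : ((g : ℂ) • 1 - A * Aᴴ)ᴴ = (g : ℂ) • 1 - A * Aᴴ := by
    rw [conjTranspose_sub, conjTranspose_smul, conjTranspose_one, conjTranspose_mul,
      conjTranspose_conjTranspose]
    congr 2
    exact Complex.conj_ofReal g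
  have h5 : (((g : ℂ) • 1 - A * Aᴴ)ᴴ * P * ((g : ℂ) • 1 - A * Aᴴ)).trace +
      ((Aᴴ * P * A) * diagonal fun r => ((g - d r : ℝ) : ℂ)).trace =
      (g : ℂ) * ((g : ℂ) * P.trace - (Aᴴ * P * A).trace) := by
    have e1 : (A * Aᴴ * P * (A * Aᴴ)).trace = (Aᴴ * P * A * (Aᴴ * A)).trace := by
      rw [Matrix.mul_assoc A, Matrix.mul_assoc A, trace_mul_comm A]
      simp only [Matrix.mul_assoc]
    have e2 : (P * (A * Aᴴ)).trace = (Aᴴ * P * A).trace := by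
      rw [← Matrix.mul_assoc, trace_mul_comm, ← Matrix.mul_assoc]
    have e3 : (A * Aᴴ * P).trace = (Aᴴ * P * A).trace := by
      rw [Matrix.mul_assoc, trace_mul_comm]
    rw [h3, h4]
    simp only [sub_mul, mul_sub, smul_mul_assoc, mul_smul_comm, Matrix.one_mul, Matrix.mul_one,
      trace_sub, trace_smul, smul_eq_mul, e1, e2, e3]
    ring
  have h6 := congrArg Complex.re h5
  rw [Complex.add_re, Complex.re_ofReal_mul, Complex.sub_re, Complex.re_ofReal_mul] at h6
  rw [Complex.zero_re] at h1
  by_contra! hcon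
  nlinarith [mul_pos hg (sub_pos.2 hcon)]

/-- After squaring, the gap is a perfect square vanishing at g = (2 + √2)/4. -/
theorem add_sqrt_le {g : ℝ} (hg : g ≤ 1) : g + √(g * (1 - g)) ≤ (1 + √2) / 2 := by
  have h2 : √2 ^ 2 = 2 := Real.sq_sqrt (by norm_num)
  have h2' : 1 ≤ √2 := by
    rw [show (1 : ℝ) = √1 by simp]
    exact Real.sqrt_le_sqrt (by norm_num)
  have : √(g * (1 - g)) ≤ (1 + √2) / 2 - g := by
    refine Real.sqrt_le_iff.2 ⟨by linarith, ?_⟩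
    nlinarith [sq_nonneg (4 * g - (2 + √2))]
  linarith

end PartialSums

/-! ### The sum of the two largest eigenvalues -/

section TwoEigenvalues

variable {n : ℕ} {W : BipartiteMatrix 2 n}

/-- The rows of `M` belonging to the `i`-th block. -/
def blockRows {κ : Type*} (M : Matrix (Fin 2 × Fin n) κ ℂ) (i : Fin 2) : Matrix (Fin n) κ ℂ :=
  of fun k r => M (i, k) r

theorem blockRows_gram {κ : Type*} (M : Matrix (Fin 2 × Fin n) κ ℂ) :
    Mᴴ * M = (blockRows M 0)ᴴ * blockRows M 0 + (blockRows M 1)ᴴ * blockRows M 1 := by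
  ext r s
  simp [mul_apply, Fintype.sum_prod_type, blockRows]

theorem conj_trace_split (hW : W.IsHermitian) {κ : Type*} [Fintype κ]
    (M : Matrix (Fin 2 × Fin n) κ ℂ) :
    (Mᴴ * W * M).trace.re = ((blockRows M 0)ᴴ * tensorBlock W 0 0 * blockRows M 0).trace.re +
      ((blockRows M 1)ᴴ * tensorBlock W 1 1 * blockRows M 1).trace.re +
      2 * ((blockRows M 0)ᴴ * tensorBlock W 0 1 * blockRows M 1).trace.re := by
  have h1 : ((blockRows M 1)ᴴ * tensorBlock W 1 0 * blockRows M 0).trace =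
      star ((blockRows M 0)ᴴ * tensorBlock W 0 1 * blockRows M 1).trace := by
    rw [← trace_conjTranspose, conjTranspose_mul, conjTranspose_mul, conjTranspose_conjTranspose,
      tensorBlock_conjTranspose hW, Matrix.mul_assoc]
  have h2 : Mᴴ * W * M = ∑ i, ∑ j, (blockRows M i)ᴴ * tensorBlock W i j * blockRows M j := by
    ext r s
    simp only [Matrix.mul_assoc]
    simp only [Matrix.sum_apply, mul_apply, Fintype.sum_prod_type,
      conjTranspose_apply, blockRows, tensorBlock, of_apply, Finset.mul_sum]
    exact Finset.sum_congr rfl fun i _ => Finset.sum_comm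
  rw [h2]
  simp only [Fin.sum_univ_two, trace_add, h1, Complex.add_re]
  change _ + _ + ((starRingEnd ℂ _).re + _) = _
  rw [Complex.conj_re]
  ring

theorem IsBlockPositive.posSemidef_tensorBlock (hW : IsBlockPositive W) (i : Fin 2) :
    (tensorBlock W i i).PosSemidef := by
  have h := hW.posSemidef_partialForm (Pi.single i 1)
  have : partialForm W (Pi.single i 1) = tensorBlock W i i := by
    fin_cases i <;> simp [partialForm]
  rwa [this] at h

/-- Rescaling both halves of each column to squared length 1/2 produces an orthonormal pair. Since d
1 = 1 - d 0, both columns acquire the same factor in the cross term, so the bound for orthonormal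
families applies to the whole trace. -/
theorem IsBlockPositive.offDiagonal_diagonal_le (hW : IsBlockPositive W) (htr : W.trace = 1)
    {M : Matrix (Fin 2 × Fin n) (Fin 2) ℂ} {d : Fin 2 → ℝ} (hd1 : d 0 + d 1 = 1)
    (h0 : (blockRows M 0)ᴴ * blockRows M 0 = diagonal fun r => (d r : ℂ))
    (h1 : (blockRows M 1)ᴴ * blockRows M 1 = diagonal fun r => ((1 - d r : ℝ) : ℂ))
    (hpos : ∀ r, 0 < d r) :
    2 * ‖((blockRows M 0)ᴴ * tensorBlock W 0 1 * blockRows M 1).trace‖ ≤ √(d 0 * (1 - d 0)) := by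
  set α : Fin 2 → ℝ := fun r => (√(2 * d r))⁻¹ with hα
  set β : Fin 2 → ℝ := fun r => (√(2 * (1 - d r)))⁻¹ with hβ
  have hpos' : ∀ r, 0 < 1 - d r := by
    intro r
    fin_cases r
    · simpa [← hd1] using hpos 1
    · simpa [← hd1] using hpos 0
  have hα2 : ∀ r, α r * α r * d r = 1 / 2 := fun r => by
    have := hpos r
    simp only [hα]
    rw [← mul_inv, Real.mul_self_sqrt (by positivity)]
    field_simp
  have hβ2 : ∀ r, β r * β r * (1 - d r) = 1 / 2 := fun r => by
    have := hpos' r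
    simp only [hβ]
    rw [← mul_inv, Real.mul_self_sqrt (by positivity)]
    field_simp
  set γ := √(d 0 * (1 - d 0)) with hγ
  have hγ0 : 0 < γ := Real.sqrt_pos.2 (mul_pos (hpos 0) (hpos' 0))
  have hαβ : ∀ r, α r * β r = (2 * γ)⁻¹ := by
    have key : (√(2 * d 0))⁻¹ * (√(2 * (1 - d 0)))⁻¹ = (2 * γ)⁻¹ := by
      rw [← mul_inv, ← Real.sqrt_mul (by have := hpos 0; positivity), hγ]
      congr 1
      rw [show 2 * d 0 * (2 * (1 - d 0)) = 2 ^ 2 * (d 0 * (1 - d 0)) by ring,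
        Real.sqrt_mul (by norm_num), Real.sqrt_sq (by norm_num)]
    intro r
    fin_cases r
    · exact key
    · simp only [hα, hβ, Fin.mk_one]
      rw [show d 1 = 1 - d 0 by linarith, sub_sub_cancel, mul_comm]
      exact key
  set w : Fin 2 → Fin 2 × Fin n → ℂ := fun r p =>
    (if p.1 = 0 then (α r : ℂ) else (β r : ℂ)) * M p r with hw
  have hgram : ∀ i r s, ∑ k, star (M (i, k) r) * M (i, k) s =
      ((blockRows M i)ᴴ * blockRows M i) r s := fun i r s => by
    simp [mul_apply, blockRows]
  have hwo : ∀ r s, star (w r) ⬝ᵥ w s = if r = s then 1 else 0 := by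
    intro r s
    have : star (w r) ⬝ᵥ w s = α r * α s * ∑ k, star (M (0, k) r) * M (0, k) s +
        β r * β s * ∑ k, star (M (1, k) r) * M (1, k) s := by
      simp only [dotProduct, Fintype.sum_prod_type, Fin.sum_univ_two, Pi.star_apply, hw, star_mul',
        Finset.mul_sum, if_true, one_ne_zero, if_false]
      congr 1 <;> refine Finset.sum_congr rfl fun k _ => ?_
      · change starRingEnd ℂ (α r : ℂ) * _ * _ = _
        rw [Complex.conj_ofReal]
        ring
      · change starRingEnd ℂ (β r : ℂ) * _ * _ = _
        rw [Complex.conj_ofReal]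
        ring
    rw [this, hgram, hgram, h0, h1, diagonal_apply, diagonal_apply]
    by_cases h : r = s
    · subst h
      simp only [if_true, ← Complex.ofReal_mul, hα2, hβ2]
      norm_num
    · simp [h]
  have hb := hW.norm_offDiagonal_le hwo
  obtain ⟨-, -, -, hb'⟩ := hW.trace_tensorBlock_bounds htr
  have hsum : ∑ r, star (fun k => w r (0, k)) ⬝ᵥ tensorBlock W 0 1 *ᵥ (fun k => w r (1, k)) =
      (((2 * γ)⁻¹ : ℝ) : ℂ) *
        ((blockRows M 0)ᴴ * tensorBlock W 0 1 * blockRows M 1).trace := by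
    rw [trace, Finset.mul_sum]
    refine Finset.sum_congr rfl fun r _ => ?_
    rw [← hαβ r, Matrix.mul_assoc]
    simp only [dotProduct, mulVec, Pi.star_apply, hw, if_true, one_ne_zero, if_false, diag_apply,
      mul_apply, conjTranspose_apply, blockRows, of_apply, Finset.mul_sum, star_mul']
    refine Finset.sum_congr rfl fun k _ => Finset.sum_congr rfl fun l _ => ?_
    change starRingEnd ℂ (α r : ℂ) * _ * _ = _
    rw [Complex.conj_ofReal]
    push_cast
    ring
  rw [hsum, norm_mul, Complex.norm_real, Real.norm_eq_abs, abs_of_pos (by positivity)] at hb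
  have h3 := hb.trans hb'
  have h4 : 2 * ((2 * γ)⁻¹ * ‖((blockRows M 0)ᴴ * tensorBlock W 0 1 * blockRows M 1).trace‖) =
      ‖((blockRows M 0)ᴴ * tensorBlock W 0 1 * blockRows M 1).trace‖ / γ := by
    field_simp
  rw [h4, div_le_iff₀ hγ0] at h3
  linarith

/-- With g the larger of d 0 and d 1, the diagonal blocks contribute at most g · tr W = g and the
cross terms at most √(g(1 - g)). -/
theorem IsBlockPositive.trace_conj_le_of_diagonal (hW : IsBlockPositive W) (htr : W.trace = 1)
    {M : Matrix (Fin 2 × Fin n) (Fin 2) ℂ} (hM : Mᴴ * M = 1) {d : Fin 2 → ℝ}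
    (hd1 : d 0 + d 1 = 1)
    (h0 : (blockRows M 0)ᴴ * blockRows M 0 = diagonal fun r => (d r : ℂ)) :
    (Mᴴ * W * M).trace.re ≤ (1 + √2) / 2 := by
  have h1 : (blockRows M 1)ᴴ * blockRows M 1 = diagonal fun r => ((1 - d r : ℝ) : ℂ) := by
    have h := blockRows_gram M
    rw [hM, h0] at h
    rw [← sub_eq_iff_eq_add'.2 h, ← diagonal_one, diagonal_sub]
    simp
  have hd0 : ∀ r, 0 ≤ d r := fun r => by
    have h := (posSemidef_conjTranspose_mul_self (blockRows M 0)).diag_nonneg (i := r)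
    rw [h0, diagonal_apply_eq] at h
    exact_mod_cast h
  set g := max (d 0) (d 1) with hg
  have hdg : ∀ r, d r ≤ g := fun r => by fin_cases r <;> simp [hg]
  have hdg' : ∀ r, 1 - d r ≤ g := fun r => by
    have a := hdg 0
    have b := hdg 1
    fin_cases r <;> simp only [Fin.zero_eta, Fin.mk_one] <;> linarith
  have hg0 : 0 < g := by
    have a := hdg 0
    have b := hdg 1
    linarith
  have hg1 : g ≤ 1 := max_le (by linarith [hd0 1]) (by linarith [hd0 0])
  have hgg : d 0 * (1 - d 0) = g * (1 - g) := by
    rcases max_choice (d 0) (d 1) with h | h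
    · rw [hg, h]
    · rw [hg, h, show d 1 = 1 - d 0 by linarith]
      ring
  have b0 := (hW.posSemidef_tensorBlock 0).trace_conj_le h0 hg0 hdg
  have b1 := (hW.posSemidef_tensorBlock 1).trace_conj_le h1 hg0 hdg'
  have b2 : 2 * ‖((blockRows M 0)ᴴ * tensorBlock W 0 1 * blockRows M 1).trace‖ ≤
      √(g * (1 - g)) := by
    rw [← hgg]
    by_cases hpos : ∀ r, 0 < d r
    · exact hW.offDiagonal_diagonal_le htr hd1 h0 h1 hpos
    -- In the degenerate case d takes the values 0 and 1, so one half of each column vanishes.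
    · have hz : ((blockRows M 0)ᴴ * tensorBlock W 0 1 * blockRows M 1).trace = 0 := by
        have hcol : ∀ (A : Matrix (Fin n) (Fin 2) ℂ) r, (Aᴴ * A) r r = 0 → ∀ k, A k r = 0 := by
          intro A r hA k
          rw [mul_apply] at hA
          have h2 : star (fun k => A k r) ⬝ᵥ (fun k => A k r) = 0 := hA
          exact congrFun (dotProduct_star_self_eq_zero.1 h2) k
        rw [trace]
        refine Finset.sum_eq_zero fun r _ => ?_
        by_cases hr : d r = 0
        · have := hcol (blockRows M 0) r (by rw [h0, diagonal_apply_eq, hr, Complex.ofReal_zero])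
          rw [diag_apply, Matrix.mul_assoc, mul_apply]
          exact Finset.sum_eq_zero fun k _ => by rw [conjTranspose_apply, this, star_zero, zero_mul]
        · have hr1 : 1 - d r = 0 := by
            push Not at hpos
            obtain ⟨s, hs⟩ := hpos
            have hs0 := le_antisymm hs (hd0 s)
            fin_cases r <;> fin_cases s <;> simp_all
          have := hcol (blockRows M 1) r (by rw [h1, diagonal_apply_eq, hr1, Complex.ofReal_zero])
          rw [diag_apply, mul_apply]
          exact Finset.sum_eq_zero fun k _ => by rw [this, mul_zero]
      rw [hz, norm_zero, mul_zero]
      exact Real.sqrt_nonneg _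
  obtain ⟨-, -, htt, -⟩ := hW.trace_tensorBlock_bounds htr
  rw [conj_trace_split hW.isHermitian]
  have b3 := Complex.re_le_norm ((blockRows M 0)ᴴ * tensorBlock W 0 1 * blockRows M 1).trace
  have b4 := add_sqrt_le hg1
  have b5 : g * (tensorBlock W 0 0).trace.re + g * (tensorBlock W 1 1).trace.re = g := by
    rw [← mul_add, htt, mul_one]
  linarith

/-- A unitary change of the two columns preserves the trace and diagonalizes the Gram matrix of the
upper half. -/
theorem IsBlockPositive.trace_conj_le_of_balanced (hW : IsBlockPositive W) (htr : W.trace = 1)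
    {M : Matrix (Fin 2 × Fin n) (Fin 2) ℂ} (hM : Mᴴ * M = 1)
    (h0 : ((blockRows M 0)ᴴ * blockRows M 0).trace = 1) :
    (Mᴴ * W * M).trace.re ≤ (1 + √2) / 2 := by
  have hG : ((blockRows M 0)ᴴ * blockRows M 0).IsHermitian := isHermitian_conjTranspose_mul_self _
  set V : Matrix (Fin 2) (Fin 2) ℂ := (hG.eigenvectorUnitary : Matrix (Fin 2) (Fin 2) ℂ) with hV
  have hVV : V * Vᴴ = 1 := Unitary.coe_mul_star_self hG.eigenvectorUnitary
  have hVV' : Vᴴ * V = 1 := mul_eq_one_comm.1 hVV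
  have hD : Vᴴ * ((blockRows M 0)ᴴ * blockRows M 0) * V =
      diagonal (fun j => (hG.eigenvalues j : ℂ)) := by
    have := hG.conjStarAlgAut_star_eigenvectorUnitary
    rw [Unitary.conjStarAlgAut_star_apply] at this
    exact this
  have hb : blockRows (M * V) 0 = blockRows M 0 * V := by
    ext k r
    simp [blockRows, mul_apply]
  have hsum : hG.eigenvalues 0 + hG.eigenvalues 1 = 1 := by
    have h := hG.trace_eq_sum_eigenvalues
    rw [h0, Fin.sum_univ_two] at h
    have h' := congrArg Complex.re h
    simpa using h'.symm
  have h := hW.trace_conj_le_of_diagonal htr (M := M * V) (d := hG.eigenvalues)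
    (by rw [conjTranspose_mul, Matrix.mul_assoc, ← Matrix.mul_assoc Mᴴ, hM, Matrix.one_mul, hVV'])
    hsum (by rw [hb, conjTranspose_mul, ← hD]; simp only [Matrix.mul_assoc])
  have e : ((M * V)ᴴ * W * (M * V)).trace = (Mᴴ * W * M).trace := by
    rw [conjTranspose_mul, Matrix.mul_assoc, Matrix.mul_assoc, trace_mul_comm]
    simp only [Matrix.mul_assoc, hVV, Matrix.mul_one]
  rwa [e] at h

theorem exists_phase_re_mul_eq_zero (c : ℂ) : ∃ z : ℂ, star z * z = 1 ∧ (z * c).re = 0 := by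
  by_cases hc : c = 0
  · exact ⟨1, by simp, by simp [hc]⟩
  · have hn : (‖c‖ : ℂ) ≠ 0 := by exact_mod_cast norm_ne_zero_iff.2 hc
    have h1 : starRingEnd ℂ c * c = (‖c‖ : ℂ) ^ 2 := Complex.conj_mul' c
    refine ⟨Complex.I * starRingEnd ℂ c / ‖c‖, ?_, ?_⟩
    · change starRingEnd ℂ _ * _ = 1
      rw [map_div₀, map_mul, Complex.conj_I, Complex.conj_conj, Complex.conj_ofReal]
      field_simp
      linear_combination (-Complex.I ^ 2) * h1 - (‖c‖ : ℂ) ^ 2 * Complex.I_sq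
    · have : Complex.I * starRingEnd ℂ c / ‖c‖ * c = Complex.I * (‖c‖ : ℂ) := by
        field_simp
        linear_combination h1
      rw [this]
      simp

/-- The sum of `⟨w, W w⟩` over an orthonormal pair is at most `(1 + √2) / 2`. -/
theorem IsBlockPositive.trace_conj_le (hW : IsBlockPositive W) (htr : W.trace = 1)
    {M : Matrix (Fin 2 × Fin n) (Fin 2) ℂ} (hM : Mᴴ * M = 1) :
    (Mᴴ * W * M).trace.re ≤ (1 + √2) / 2 := by
  set ρ : Fin 2 → Fin 2 → ℂ := fun i j => ((blockRows M i)ᴴ * blockRows M j).trace with hρ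
  have hρ1 : ρ 0 0 + ρ 1 1 = 2 := by
    have h := congrArg trace (blockRows_gram M)
    rw [hM, trace_add, trace_one] at h
    simpa using h.symm
  have hρ2 : ρ 1 0 = star (ρ 0 1) := by
    simp only [hρ]
    rw [← trace_conjTranspose, conjTranspose_mul, conjTranspose_conjTranspose]
  obtain ⟨z, hz, hzc⟩ := exists_phase_re_mul_eq_zero (ρ 1 0)
  have hzz : z * star z = 1 := by rw [mul_comm, hz]
  have hzc' : star z * ρ 0 1 + z * ρ 1 0 = 0 := by
    have : star z * ρ 0 1 = starRingEnd ℂ (z * ρ 1 0) := by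
      rw [hρ2]
      simp
    rw [this, add_comm, Complex.add_conj, hzc]
    simp
  set r : ℂ := (((√2)⁻¹ : ℝ) : ℂ) with hr
  have hrr : star r = r := Complex.conj_ofReal _
  have hr2 : r * r = 1 / 2 := by
    rw [hr, ← Complex.ofReal_mul, ← mul_inv, Real.mul_self_sqrt (by norm_num)]
    norm_num
  -- The columns are (1, ±z)/√2. The Gram trace in the first direction is half of ρ 0 0 + ρ 1 1 plus
  -- a cross term; the phase z kills the latter, leaving 1.
  set Y : Matrix (Fin 2) (Fin 2) ℂ := !![r, r; r * z, -(r * z)] with hY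
  have hYY : Yᴴ * Y = 1 := by
    have hz' : starRingEnd ℂ z * z = 1 := hz
    have hr' : starRingEnd ℂ r = r := hrr
    ext i j
    fin_cases i <;> fin_cases j <;> simp [hY, mul_apply, Fin.sum_univ_two, hr']
    · linear_combination (r * r) * hz' + 2 * hr2
    · linear_combination -(r * r) * hz'
    · linear_combination -(r * r) * hz'
    · linear_combination (r * r) * hz' + 2 * hr2
  have hYY' : Y * Yᴴ = 1 := mul_eq_one_comm.1 hYY
  set K : Matrix (Fin 2 × Fin n) (Fin 2 × Fin n) ℂ := Y ⊗ₖ (1 : Matrix (Fin n) (Fin n) ℂ) with hK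
  have hKK : K * Kᴴ = 1 := by
    rw [hK, conjTranspose_kronecker, ← mul_kronecker_mul, hYY', conjTranspose_one, Matrix.mul_one,
      one_kronecker_one]
  have htr' : (Kᴴ * W * K).trace = 1 := by
    rw [trace_mul_cycle, hKK, Matrix.one_mul, htr]
  have hM' : (Kᴴ * M)ᴴ * (Kᴴ * M) = 1 := by
    rw [conjTranspose_mul, conjTranspose_conjTranspose, Matrix.mul_assoc, ← Matrix.mul_assoc K,
      hKK, Matrix.one_mul, hM]
  have hb : blockRows (Kᴴ * M) 0 = r • blockRows M 0 + (r * star z) • blockRows M 1 := by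
    ext k s
    have hk : ∀ (j : Fin 2) (l : Fin n), Kᴴ (0, k) (j, l) * M (j, l) s =
        if l = k then star (Y j 0) * M (j, l) s else 0 := fun j l => by
      by_cases h : l = k <;> simp [hK, h]
    simp only [blockRows, of_apply, Matrix.mul_apply, Fintype.sum_prod_type, hk, Finset.sum_ite_eq',
      Finset.mem_univ, if_true, Fin.sum_univ_two, Matrix.add_apply, Matrix.smul_apply, smul_eq_mul]
    simp [hY, hrr, star_mul']
  have h0 : ((blockRows (Kᴴ * M) 0)ᴴ * blockRows (Kᴴ * M) 0).trace = 1 := by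
    have e : ((blockRows (Kᴴ * M) 0)ᴴ * blockRows (Kᴴ * M) 0).trace =
        r * r * (ρ 0 0 + star z * ρ 0 1 + (z * ρ 1 0 + z * star z * ρ 1 1)) := by
      rw [hb]
      simp only [conjTranspose_add, conjTranspose_smul, Matrix.add_mul, Matrix.mul_add,
        Matrix.smul_mul, Matrix.mul_smul, trace_add, trace_smul, smul_eq_mul, star_mul', hrr, star_star, hρ]
      ring
    rw [e, hr2, hzz]
    linear_combination (1 / 2) * hzc' + (1 / 2) * hρ1
  have h := (hW.localConj Y (1 : Matrix (Fin n) (Fin n) ℂ)).trace_conj_le_of_balanced htr' hM' h0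
  have e : (Kᴴ * M)ᴴ * (Kᴴ * W * K) * (Kᴴ * M) = Mᴴ * W * M := by
    rw [conjTranspose_mul, conjTranspose_conjTranspose]
    calc Mᴴ * K * (Kᴴ * W * K) * (Kᴴ * M) = Mᴴ * ((K * Kᴴ) * W * (K * Kᴴ)) * M := by
          simp only [Matrix.mul_assoc]
      _ = Mᴴ * W * M := by rw [hKK, Matrix.one_mul, Matrix.mul_one]
  rwa [e] at h

end TwoEigenvalues

/-! ### Assembly -/

section Assembly

variable {m n : ℕ}

theorem one_lt_card_of_sum_eq_one {d : ℕ} {μ : Fin d → ℝ} (h1 : ∑ k, μ k = 1) {j : Fin d}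
    (hj : μ j < 0) : 1 < d := by
  by_contra! hd
  have : Subsingleton (Fin d) := Fin.subsingleton_iff_le_one.2 hd
  rw [Finset.sum_eq_single j (fun k _ hk => absurd (Subsingleton.elim k j) hk) (by simp)] at h1
  linarith

theorem SortedEigenbasis.sum_tail_ge {W : BipartiteMatrix 2 n} (hW : IsBlockPositive W)
    (htr : W.trace = 1) {μ : Fin (2 * n) → ℝ} {w : Fin (2 * n) → Fin 2 × Fin n → ℂ}
    (h : SortedEigenbasis W μ w) (s : Finset (Fin (2 * n))) : -(1 / 2) ≤ ∑ k ∈ s, μ k := by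
  have h1 := hW.neg_half_le_sum htr (w := fun k : s => w k)
    (fun k l => by rw [h.orthonormal]; simp only [Subtype.coe_inj])
  simp only [h.quadraticForm_self, Complex.ofReal_re] at h1
  rwa [Finset.sum_coe_sort s μ] at h1

theorem SortedEigenbasis.add_le {W : BipartiteMatrix 2 n} (hW : IsBlockPositive W)
    (htr : W.trace = 1) {μ : Fin (2 * n) → ℝ} {w : Fin (2 * n) → Fin 2 × Fin n → ℂ}
    (h : SortedEigenbasis W μ w) {i j : Fin (2 * n)} (hij : i ≠ j) :
    μ i + μ j ≤ (1 + √2) / 2 := by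
  set M : Matrix (Fin 2 × Fin n) (Fin 2) ℂ := of fun p r => w (![i, j] r) p with hM
  have e : ∀ (A : BipartiteMatrix 2 n) r s,
      (Mᴴ * A * M) r s = star (w (![i, j] r)) ⬝ᵥ A *ᵥ w (![i, j] s) := by
    intro A r s
    rw [Matrix.mul_assoc]
    rfl
  have hMM : Mᴴ * M = 1 := by
    ext r s
    have := e 1 r s
    rw [Matrix.mul_one, one_mulVec, h.orthonormal] at this
    rw [this, one_apply]
    fin_cases r <;> fin_cases s <;> simp [hij, hij.symm]
  have h1 := hW.trace_conj_le htr hMM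
  rw [trace, Fin.sum_univ_two, diag_apply, diag_apply, e, e, h.quadraticForm_self,
    h.quadraticForm_self, ← Complex.ofReal_add, Complex.ofReal_re] at h1
  simpa using h1

end Assembly

theorem mainTheorem6 (m n : ℕ) (W : BipartiteMatrix m n) (hW : IsEntanglementWitness W)
    (htr : W.trace = 1) :
    -- (i)
    (W * W).trace.re ∈ Set.Ioc (1 / ((m : ℝ) * (n : ℝ) - 1)) 1 ∧
    -- (ii)
    (sortedEigenvalue hW.isHermitian (m * n) ∈ Set.Ico (-1 / 2 : ℝ) 0 ∧
      (sortedEigenvalue hW.isHermitian (m * n) = -1 / 2 → IsOptimalWitness W)) ∧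
    -- (iii)
    sortedEigenvalue hW.isHermitian 1 ∈ Set.Ioo (1 / ((m : ℝ) * (n : ℝ) - 1)) 1 ∧
    -- (iv)
    (m = 2 →
      0 ≤ sortedEigenvalue hW.isHermitian 2 + sortedEigenvalue hW.isHermitian (2 * n) ∧
      -(1 / (2 + 2 * √2)) ≤ ∑ i ∈ Finset.Icc 3 (2 * n), sortedEigenvalue hW.isHermitian i ∧
      ∀ k : ℕ, 4 ≤ k → k ≤ 2 * n →
        -1 / 2 ≤ ∑ i ∈ Finset.Icc k (2 * n), sortedEigenvalue hW.isHermitian i) ∧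
    -- (v)
    (m = n →
      negativity W ≤ ((m : ℝ) - 1) / 2 ∧
      (negativity W = ((m : ℝ) - 1) / 2 →
        IsOptimalWitness W ∧
        ((Finset.Icc 1 (m * n)).filter
          (fun k => sortedEigenvalue hW.isHermitian k = 1 / (m : ℝ))).card = m * (m + 1) / 2 ∧
        ((Finset.Icc 1 (m * n)).filter
          (fun k => sortedEigenvalue hW.isHermitian k = -(1 / (m : ℝ)))).card
            = m * (m - 1) / 2)) := by
  obtain ⟨μ, w, hs, hsort, hall⟩ := hW.isHermitian.exists_sortedEigenbasis
  have hbp := hW.toIsBlockPositive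
  obtain ⟨j, hj⟩ : ∃ j, μ j < 0 := by
    obtain ⟨i, hi⟩ := hW.exists_neg
    obtain ⟨k, hk⟩ := hall i
    exact ⟨k, hk ▸ hi⟩
  have hsum : ∑ k, μ k = 1 := by
    have := hs.trace_eq
    rw [htr] at this
    exact_mod_cast this.symm
  have hd : 1 < m * n := one_lt_card_of_sum_eq_one hsum hj
  set i₀ : Fin (m * n) := ⟨0, by omega⟩ with hi₀
  set l : Fin (m * n) := ⟨m * n - 1, by omega⟩ with hl
  have hi₀l : i₀ ≠ l := fun h => by
    have := congrArg Fin.val h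
    simp only [hi₀, hl] at this
    omega
  have e1 : sortedEigenvalue hW.isHermitian 1 = μ i₀ := hsort i₀
  have el : sortedEigenvalue hW.isHermitian (m * n) = μ l := by
    rw [← hsort l]
    congr 1
    simp only [hl]
    omega
  have hcard : (Fintype.card (Fin (m * n)) : ℝ) = (m : ℝ) * n := by simp
  have hsq : (W * W).trace.re = ∑ k, μ k ^ 2 := by
    rw [hs.trace_mul_self_eq, Complex.ofReal_re]
  have hsq1 : ∑ k, μ k ^ 2 ≤ 1 := by
    have := hbp.trace_mul_self_le
    rwa [htr, mul_one, Complex.one_re, hsq] at this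
  have hll : μ l < 0 := (hs.antitone (by rw [Fin.le_def]; simp only [hl]; omega)).trans_lt hj
  have hw1 : ∀ k, star (w k) ⬝ᵥ w k = 1 := fun k => by rw [hs.orthonormal, if_pos rfl]
  have hge : -(1 / 2) ≤ μ l := by
    have := hbp.neg_half_trace_le (hw1 l)
    rwa [htr, Complex.one_re, mul_one, hs.quadraticForm_self, Complex.ofReal_re] at this
  refine ⟨?_, ?_, ?_, ?_, ?_⟩
  · rw [hsq, ← hcard]
    exact ⟨one_div_lt_sum_sq hsum hj, hsq1⟩
  · rw [el]
    refine ⟨⟨by linarith, hll⟩, fun h => ?_⟩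
    refine hW.isOptimalWitness_of_eigenvalue htr (hw1 l) ?_
    rw [hs.quadraticForm_self, Complex.ofReal_re, h]
    norm_num
  · rw [e1, ← hcard]
    refine ⟨one_div_lt_of_forall_le hsum hj fun k =>
      hs.antitone (by rw [Fin.le_def]; exact Nat.zero_le _), ?_⟩
    -- The square of the negative least eigenvalue takes a positive share of tr W² ≤ 1, which makes
    -- λ₁ < 1 strict.
    have h1 : μ i₀ ^ 2 + μ l ^ 2 ≤ ∑ k, μ k ^ 2 := by
      rw [← Finset.sum_pair (f := fun k => μ k ^ 2) hi₀l]
      exact Finset.sum_le_sum_of_subset_of_nonneg (Finset.subset_univ _) fun _ _ _ => sq_nonneg _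
    nlinarith [mul_pos_of_neg_of_neg hll hll]
  · intro hm
    subst hm
    set i₁ : Fin (2 * n) := ⟨1, hd⟩ with hi₁
    have hi₀₁ : i₀ ≠ i₁ := fun h => by
      have := congrArg Fin.val h
      simp [hi₀, hi₁] at this
    have e2 : sortedEigenvalue hW.isHermitian 2 = μ i₁ := hsort i₁
    refine ⟨?_, ?_, ?_⟩
    · rw [el, e2]
      exact hbp.add_nonneg_of_sortedEigenbasis hs rfl rfl hi₀l hll
    · have h1 := sum_Icc_eq_sum_fin (a := 2) _ _ hsort
      -- Indices 0 and 1 carry λ₁ and λ₂, so the tail is one minus their sum.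
      have h2 : ∑ k ∈ Finset.univ.filter (fun k : Fin (2 * n) => 2 ≤ (k : ℕ)), μ k =
          1 - (μ i₀ + μ i₁) := by
        rw [← hsum, ← Finset.sum_pair hi₀₁, eq_sub_iff_add_eq,
          ← Finset.sum_filter_add_sum_filter_not Finset.univ fun k : Fin (2 * n) => 2 ≤ (k : ℕ)]
        congr 1
        refine Finset.sum_congr ?_ fun _ _ => rfl
        ext k
        simp only [Finset.mem_insert, Finset.mem_singleton, Finset.mem_filter, Finset.mem_univ,
          true_and, Fin.ext_iff, hi₀, hi₁]
        omega
      rw [show (3 : ℕ) = 2 + 1 from rfl, h1, h2]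
      have h3 := hs.add_le hbp htr hi₀₁
      have h4 : 1 / (2 + 2 * √2) = (√2 - 1) / 2 := by
        have : √2 ^ 2 = 2 := Real.sq_sqrt (by norm_num)
        have h0 : (0 : ℝ) ≤ √2 := Real.sqrt_nonneg _
        rw [div_eq_div_iff (by positivity) (by norm_num)]
        linear_combination -2 * this
      rw [h4]
      linarith
    · intro k hk _
      -- Rank k corresponds to index k - 1.
      have h1 := sum_Icc_eq_sum_fin (a := k - 1) _ _ hsort
      rw [Nat.sub_add_cancel (by omega : 1 ≤ k)] at h1
      rw [h1]
      have := hs.sum_tail_ge hbp htr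
        (Finset.univ.filter (fun i : Fin (2 * n) => k - 1 ≤ (i : ℕ)))
      linarith
  · intro hmn
    subst hmn
    have hm : 1 < m := by
      by_contra! h
      have := Nat.mul_le_mul h h
      omega
    have hm0 : 0 < m := by omega
    refine ⟨?_, fun heq => ?_⟩
    · have := hbp.traceNorm_le hm0 htr
      rw [negativity]
      linarith
    · have htn : traceNorm W = m := by
        rw [negativity] at heq
        linarith
      have hWW := hbp.mul_self_of_traceNorm_eq hm0 htr htn
      refine ⟨hW.isOptimalWitness_of_mul_self hm htr hWW, ?_⟩
      have hμ : ∀ k, μ k ^ 2 = (m : ℝ)⁻¹ ^ 2 := by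
        intro k
        have h1 : star (w k) ⬝ᵥ (W * W) *ᵥ w k = ((μ k ^ 2 : ℝ) : ℂ) := by
          rw [← mulVec_mulVec, hs.eigen, mulVec_smul, dotProduct_smul, hs.quadraticForm_self]
          simp [sq]
        rw [hWW, smul_mulVec, one_mulVec, dotProduct_smul, hw1, smul_eq_mul, mul_one] at h1
        exact_mod_cast h1.symm
      have hc := card_of_forall_sq_eq hm0 (by simp) hsum hμ
      rw [card_filter_Icc_eq _ _ hsort, card_filter_Icc_eq _ _ hsort]
      exact hc
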